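/- Let $T^2=\{(x,y): 0\le x,\ 0\le y\le 1-x\}$, let $K\in L^2(T^2)$ (real or complex valued), and put $(\mathcal V_K u)(x)=\int_0^{1-x}K(x,y)u(y)\,\mathrm dy$. Bases. Let $\tilde P_n^{(a,b)}(x)=P_n^{(a,b)}(2x-1)$ be the Jacobi polynomials shifted to $[0,1]$. Let $p_n=\sqrt{2n+2}\,\tilde P_n^{(1,0)}$, the orthonormal Jacobi polynomials of $L^2((0,1),(1-x)\,\mathrm dx)$, and, for $0\le k\le n$, let $p_{n,k}(x,y)=\sqrt{(2n+2)(2k+1)}\,(1-x)^k\tilde P^{(2k+1,0)}_{n-k}(x)\,\tilde P^{(0,0)}_k\!\left(\tfrac{y}{1-x}\right)$, the orthonormal Jacobi polynomials of $L^2(T^2)$. For a function $u$ on $(0,1)$ let $\mathcal E u=\big(\int_0^1(1-x)p_n(x)u(x)\,\mathrm dx\big)_{n\ge 0}$ be its coefficient vector. Then $\ell^2$ is the set of coefficient vectors of the $u$ with $\int_0^1(1-x)|u|^2\,\mathrm dx<\infty$. Let $\mathcal C=\mathcal E(L^2(0,1))\subset\ell^2$ be the Banach space of coefficient vectors of functions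 in $L^2(0,1)$, normed by $\|\mathcal E u\|_{\mathcal C}=\|u\|_{L^2(0,1)}$, so that the analysis operator $\mathcal E:L^2(0,1)\to\mathcal C$ and the synthesis operator $\mathcal E^{-1}$ are bounded. Operators. Let $\mathrm J$, $\mathrm E_y$, $\mathrm Q_y$, $\mathrm J_x$, $\mathrm J_y$ and $K(\mathrm J_x,\mathrm J_y)$ be the infinite matrices, in these bases, of: multiplication by $x$ on the interval; $u\mapsto\big((x,y)\mapsto u(y)\big)$; $f\mapsto (1-x)^{-1}\int_0^{1-x}f(x,y)\,\mathrm dy$; and multiplication by $x$, by $y$ and by $K(x,y)$ on $T^2$. If $K(x,y)=\sum_{n\le N}\sum_{j\le n}k_{nj}x^{n-j}y^j$ is a polynomial, then $K(\mathrm J_x,\mathrm J_y)=\sum_{n\le N}\sum_{j\le n}k_{nj}\mathrm J_x^{n-j}\mathrm J_y^j$. Then: 1. For every $u$ with $\mathcal Eu\in\ell^2$, i.e. $\int_0^1(1-x)|u|^2\,\mathrm dx<\infty$, the integral $(\mathcal V_Ku)(x)$ converges for almost every $x$, $\mathcal V_Ku\in L^1(0,1)$, all the series in $(\mathbb 1-\mathrm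 J)\mathrm Q_yK(\mathrm J_x,\mathrm J_y)\mathrm E_y\,\mathcal Eu$ converge, and $\mathcal E\mathcal V_Ku=(\mathbb 1-\mathrm J)\mathrm Q_yK(\mathrm J_x,\mathrm J_y)\mathrm E_y\,\mathcal Eu$. That is, the coefficient-space Volterra operator is $$\mathrm V_K=(\mathbb 1-\mathrm J)\,\mathrm Q_y\,K(\mathrm J_x,\mathrm J_y)\,\mathrm E_y .$$ 2. $\mathcal V_K$ is a compact operator on $L^2(0,1)$, and $\mathrm V_K=\mathcal E\mathcal V_K\mathcal E^{-1}$ is a compact operator on $\mathcal C$. Hence the second-kind method has the form identity plus compact: with the compact operator $\mathcal K=-\mathrm V_K$, for all $u,g\in L^2(0,1)$, $u-\mathcal V_Ku=g$ holds almost everywhere if and only if $(\mathbb 1+\mathcal K)\,\mathcal Eu=\mathcal Eg$. 3. If moreover $\iint_{T^2}\frac{|K(x,y)|^2}{1-y}\,\mathrm dx\,\mathrm dy<\infty$ (for instance, if $K$ is bounded), then $\mathcal V_K$ maps $L^2((0,1),(1-x)\,\mathrm dx)$ into itself, $\mathrm V_K$ is a compact operator on the whole of $\ell^2$, and with $\mathcal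 K=-\mathrm V_K$, for all $u,g\in L^2((0,1),(1-x)\,\mathrm dx)$, $u-\mathcal V_Ku=g$ holds almost everywhere if and only if $(\mathbb 1+\mathcal K)\,\mathcal Eu=\mathcal Eg$ in $\ell^2$. -/

import Mathlib

open MeasureTheory Polynomial

noncomputable section

namespace JacobiVolterra

/-! ### Jacobi polynomials on `[0,1]` and on the triangle -/

/-- The Jacobi polynomial `P_n^{(a,b)}(2x - 1)`, shifted to `[0,1]`, in the standard normalization:
`∑ₛ C(n+a, n-s) C(n+b, s) (x - 1)^s x^(n-s)`. It is orthogonal for the weight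
`(1 - x)^a x^b` on `(0,1)`. -/
def jacobi (a b n : ℕ) : ℝ[X] :=
  ∑ s ∈ Finset.range (n + 1),
    C (((n + a).choose (n - s) * (n + b).choose s : ℕ) : ℝ) * ((X - 1) ^ s * X ^ (n - s))

/-- The shifted Jacobi polynomials `P_n^{(1,0)}(2x-1)`, scaled by `√(2n+2)` so that they are
orthonormal in `L²((0,1), (1-x)dx)`. -/
def intervalPoly (n : ℕ) (x : ℝ) : ℝ :=
  √(2 * n + 2) * (jacobi 1 0 n).eval x

/-- The index set `{(n,k) : 0 ≤ k ≤ n}` of the bivariate basis, grouped in blocks of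
total degree `n`. -/
abbrev TriIndex : Type := (n : ℕ) × Fin (n + 1)

/-- The triangle `T² = {(x,y) : 0 ≤ x, 0 ≤ y ≤ 1 - x}`. -/
def triangle : Set (ℝ × ℝ) := {p | 0 ≤ p.1 ∧ 0 ≤ p.2 ∧ p.2 ≤ 1 - p.1}

/-- The Jacobi polynomials on the triangle for the weight `1` (that is `α = β = γ = 0`),
`(1-x)^k P_{n-k}^{(2k+1,0)}(2x-1) P_k^{(0,0)}(2y/(1-x)-1)`, scaled by `√((2n+2)(2k+1))` so that
they are orthonormal in `L²(T²)`. -/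
def trianglePoly (q : TriIndex) (x y : ℝ) : ℝ :=
  √((2 * q.1 + 2) * (2 * q.2 + 1)) *
    ((1 - x) ^ (q.2 : ℕ) * (jacobi (2 * q.2 + 1) 0 (q.1 - q.2)).eval x *
      (jacobi 0 0 q.2).eval (y / (1 - x)))

/-! ### Coefficient vectors -/

section Coefficients

variable {𝕜 : Type*} [RCLike 𝕜]

/-- The coefficients of `u` in the orthonormal basis `intervalPoly` for the weight `1 - x`. -/
def intervalCoeff (u : ℝ → 𝕜) (n : ℕ) : 𝕜 :=
  ∫ x in Set.Ioo (0 : ℝ) 1, ((1 - x) * intervalPoly n x) • u x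

/-- The coefficients of `F` in the orthonormal basis `trianglePoly` on the triangle. -/
def triangleCoeff (F : ℝ → ℝ → 𝕜) (q : TriIndex) : 𝕜 :=
  ∫ p in triangle, trianglePoly q p.1 p.2 • F p.1 p.2

/-- `u` is square integrable on `(0,1)` for the Jacobi weight `1 - x`. -/
def MemWeightedL2 (u : ℝ → 𝕜) : Prop :=
  MemLp (fun x => √(1 - x) • u x) 2 (volume.restrict (Set.Ioo (0 : ℝ) 1))

end Coefficients

/-! ### The operators on coefficient vectors, as infinite matrices

Each of them is the matrix, in the bases above, of the operation on functions that it represents: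
column `j` holds the coefficients of the image of the `j`-th basis function. -/

section Matrices

variable (𝕜 : Type*) [RCLike 𝕜]

/-- `J`: multiplication by `x` on the interval. -/
def opJ (m n : ℕ) : 𝕜 :=
  intervalCoeff (fun x => ((x * intervalPoly n x : ℝ) : 𝕜)) m

/-- `E_y`: extension of `u` on `[0,1]` to `(x,y) ↦ u(y)` on the triangle. -/
def opE (p : TriIndex) (n : ℕ) : 𝕜 :=
  triangleCoeff (fun _ y => ((intervalPoly n y : ℝ) : 𝕜)) p

/-- `Q_y`: integration of `f` over `0 ≤ y ≤ 1-x`, with the weight `W_Q = 1-x` split off, that is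
`(1-x) (Q_y f)(x) = ∫_0^{1-x} f(x,y) dy`. -/
def opQ (m : ℕ) (q : TriIndex) : 𝕜 :=
  intervalCoeff
    (fun x => (((1 - x)⁻¹ * ∫ y in (0 : ℝ)..(1 - x), trianglePoly q x y : ℝ) : 𝕜)) m

variable {𝕜}

/-- `K(J_x, J_y)`: multiplication by the kernel `K(x,y)` on the triangle. -/
def opKernel (K : ℝ → ℝ → 𝕜) (p q : TriIndex) : 𝕜 :=
  triangleCoeff (fun x y => K x y * ((trianglePoly q x y : ℝ) : 𝕜)) p

variable (𝕜)

/-- `J_x`: multiplication by `x` on the triangle. -/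
def opJx : TriIndex → TriIndex → 𝕜 := opKernel (fun x _ => (x : 𝕜))

/-- `J_y`: multiplication by `y` on the triangle. -/
def opJy : TriIndex → TriIndex → 𝕜 := opKernel (fun _ y => (y : 𝕜))

variable {𝕜}

/-- The product of two infinite matrices. -/
def matMul {ι κ τ : Type*} (A : ι → κ → 𝕜) (B : κ → τ → 𝕜) (i : ι) (j : τ) : 𝕜 :=
  ∑' r, A i r * B r j

/-- The powers of an infinite matrix. -/
def matPow {ι : Type*} [DecidableEq ι] (A : ι → ι → 𝕜) : ℕ → ι → ι → 𝕜
  | 0 => fun i j => if i = j then 1 else 0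
  | n + 1 => matMul A (matPow A n)

/-- An infinite matrix applied to a coefficient vector. -/
def matVec {ι κ : Type*} (A : ι → κ → 𝕜) (c : κ → 𝕜) (i : ι) : 𝕜 :=
  ∑' j, A i j * c j

/-- All the series in `matVec A c` converge. -/
def MatVecConverges {ι κ : Type*} (A : ι → κ → 𝕜) (c : κ → 𝕜) : Prop :=
  ∀ i, Summable fun j => A i j * c j

/-- `Q_y K(J_x,J_y) E_y c`. -/
def opQKE (K : ℝ → ℝ → 𝕜) (c : ℕ → 𝕜) : ℕ → 𝕜 :=
  matVec (opQ 𝕜) (matVec (opKernel K) (matVec (opE 𝕜) c))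

/-- `(1 - J) Q_y K(J_x,J_y) E_y c`. -/
def methodOp (K : ℝ → ℝ → 𝕜) (c : ℕ → 𝕜) : ℕ → 𝕜 :=
  opQKE K c - matVec (opJ 𝕜) (opQKE K c)

/-- All the series in `(1 - J) Q_y K(J_x,J_y) E_y c` converge. -/
def MethodConverges (K : ℝ → ℝ → 𝕜) (c : ℕ → 𝕜) : Prop :=
  MatVecConverges (opE 𝕜) c ∧
  MatVecConverges (opKernel K) (matVec (opE 𝕜) c) ∧
  MatVecConverges (opQ 𝕜) (matVec (opKernel K) (matVec (opE 𝕜) c)) ∧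
  MatVecConverges (opJ 𝕜) (opQKE K c)

/-- The Volterra integral with limits `0` to `1-x`. -/
def volterra (K : ℝ → ℝ → 𝕜) (u : ℝ → 𝕜) (x : ℝ) : 𝕜 :=
  ∫ y in (0 : ℝ)..(1 - x), K x y * u y

end Matrices

/-! ### The Banach space of coefficient vectors of `L²(0,1)` -/

lemma jacobi_degree (n : ℕ) : (jacobi 1 0 n).degree = n := by
  have hle : (jacobi 1 0 n).natDegree ≤ n := by
    refine natDegree_sum_le_of_forall_le _ _ fun s hs => ?_
    have hs' : s ≤ n := Nat.lt_succ_iff.mp (Finset.mem_range.mp hs)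
    refine (natDegree_C_mul_le _ _).trans (natDegree_mul_le.trans ?_)
    have h1 : ((X - 1 : ℝ[X]) ^ s).natDegree ≤ s := by
      refine natDegree_pow_le.trans ?_
      have : (X - 1 : ℝ[X]).natDegree = 1 := by simpa using natDegree_X_sub_C (1 : ℝ)
      simp [this]
    have h2 : ((X : ℝ[X]) ^ (n - s)).natDegree ≤ n - s := by simp
    omega
  have hco : 0 < (jacobi 1 0 n).coeff n := by
    unfold jacobi
    rw [finsetSum_coeff]
    refine Finset.sum_pos (fun s hs => ?_) ⟨0, by simp⟩
    have hs' : s ≤ n := Nat.lt_succ_iff.mp (Finset.mem_range.mp hs)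
    have hm : ((X - 1 : ℝ[X]) ^ s * X ^ (n - s)).coeff n = 1 := by
      have hmon : ((X - 1 : ℝ[X]) ^ s * X ^ (n - s)).Monic := by
        have : (X - 1 : ℝ[X]).Monic := by simpa using monic_X_sub_C (1 : ℝ)
        exact (this.pow s).mul (monic_X_pow _)
      have hdeg : ((X - 1 : ℝ[X]) ^ s * X ^ (n - s)).natDegree = n := by
        have h0 : (X - 1 : ℝ[X]).Monic := by simpa using monic_X_sub_C (1 : ℝ)
        rw [(h0.pow s).natDegree_mul (monic_X_pow _), h0.natDegree_pow]
        have : (X - 1 : ℝ[X]).natDegree = 1 := by simpa using natDegree_X_sub_C (1 : ℝ)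
        rw [this]; simp; omega
      simpa [Monic, leadingCoeff, hdeg] using hmon
    rw [coeff_C_mul, hm, mul_one]
    exact_mod_cast Nat.mul_pos (Nat.choose_pos (by omega)) (Nat.choose_pos (by omega))
  exact degree_eq_of_le_of_coeff_ne_zero (natDegree_le_iff_degree_le.mp hle) hco.ne'

section CoefficientSpace

variable (𝕜 : Type*) [RCLike 𝕜]

/-- `L²(0,1)`. -/
abbrev L2I : Type _ := Lp 𝕜 2 (volume.restrict (Set.Ioo (0 : ℝ) 1))

variable {𝕜}

lemma integrable_L2I (u : L2I 𝕜) : Integrable u (volume.restrict (Set.Ioo (0 : ℝ) 1)) :=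
  (Lp.memLp u).integrable (by norm_num)

lemma integrable_smul (g : ℝ → ℝ) (hg : Continuous g) (u : L2I 𝕜) :
    Integrable (fun x => g x • u x) (volume.restrict (Set.Ioo (0 : ℝ) 1)) := by
  obtain ⟨B, hB⟩ := isCompact_Icc.exists_bound_of_continuousOn
    (s := Set.Icc (0 : ℝ) 1) hg.continuousOn
  refine (integrable_L2I u).bdd_smul B hg.aestronglyMeasurable ?_
  exact (ae_restrict_mem measurableSet_Ioo).mono fun x hx => hB x (Set.Ioo_subset_Icc_self hx)

lemma continuous_weight (n : ℕ) : Continuous fun x : ℝ => (1 - x) * intervalPoly n x := by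
  unfold intervalPoly
  fun_prop

/-- The coefficient map `L²(0,1) → 𝕜^ℕ`. -/
def coeffMap : L2I 𝕜 →ₗ[𝕜] (ℕ → 𝕜) where
  toFun u := intervalCoeff u
  map_add' u v := by
    funext n
    simp only [intervalCoeff, Pi.add_apply]
    rw [← integral_add (integrable_smul _ (continuous_weight n) u)
      (integrable_smul _ (continuous_weight n) v)]
    refine integral_congr_ae ?_
    filter_upwards [Lp.coeFn_add u v] with x hx
    rw [hx, Pi.add_apply, smul_add]
  map_smul' a u := by
    funext n
    simp only [intervalCoeff, Pi.smul_apply, RingHom.id_apply]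
    rw [← integral_smul]
    refine integral_congr_ae ?_
    filter_upwards [Lp.coeFn_smul a u] with x hx
    rw [hx, Pi.smul_apply, smul_comm]

/-- The Jacobi polynomials are complete: a function in `L²(0,1)` is determined by its
coefficients. -/
lemma coeffMap_injective : Function.Injective (coeffMap (𝕜 := 𝕜)) := by
  refine (injective_iff_map_eq_zero _).mpr fun u hu => ?_
  let S : Polynomial.Sequence ℝ := ⟨jacobi 1 0, jacobi_degree⟩
  let I : ℝ[X] → 𝕜 := fun q => ∫ x in Set.Ioo (0 : ℝ) 1, ((1 - x) * q.eval x) • u x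
  have hcont : ∀ q : ℝ[X], Continuous fun x : ℝ => (1 - x) * q.eval x := fun q => by fun_prop
  have hS : ∀ n, I (S n) = 0 := by
    intro n
    have h := congrFun hu n
    change (∫ x in Set.Ioo (0 : ℝ) 1, ((1 - x) * intervalPoly n x) • u x) = 0 at h
    have h2 : (√(2 * n + 2) : ℝ) • I (S n) = 0 := by
      rw [← h, ← integral_smul]
      refine integral_congr_ae (Filter.Eventually.of_forall fun x => ?_)
      change _ • ((1 - x) * (jacobi 1 0 n).eval x) • u x = _
      simp only [intervalPoly]
      rw [smul_smul]
      congr 1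
      ring
    exact (smul_eq_zero.mp h2).resolve_left (Real.sqrt_pos.mpr (by positivity)).ne'
  have hI : ∀ q : ℝ[X], I q = 0 := by
    intro q
    have hq : q ∈ Submodule.span ℝ (Set.range S) := by
      rw [S.span (fun i => (leadingCoeff_ne_zero.mpr (S.ne_zero i)).isUnit)]
      trivial
    induction hq using Submodule.span_induction with
    | mem q hq => obtain ⟨n, rfl⟩ := hq; exact hS n
    | zero => simp [I]
    | add p q _ _ hp hq =>
      have : I (p + q) = I p + I q := by
        simp only [I]
        rw [← integral_add (integrable_smul _ (hcont p) u) (integrable_smul _ (hcont q) u)]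
        refine integral_congr_ae (Filter.Eventually.of_forall fun x => ?_)
        simp only [eval_add]
        rw [← add_smul]
        congr 1
        ring
      rw [this, hp, hq, add_zero]
    | smul a q _ hq =>
      have : I (a • q) = a • I q := by
        simp only [I]
        rw [← integral_smul]
        refine integral_congr_ae (Filter.Eventually.of_forall fun x => ?_)
        simp only [eval_smul, smul_eq_mul]
        rw [smul_smul]
        congr 1
        ring
      rw [this, hq, smul_zero]
  set v : ℝ → 𝕜 := fun x => (1 - x) • u x with hv
  have hvi : IntegrableOn v (Set.Ioo (0 : ℝ) 1) :=
    integrable_smul (fun x => 1 - x) (by fun_prop) u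
  have hzero : ∀ g : ℝ → ℝ, Continuous g → ∫ x in Set.Ioo (0 : ℝ) 1, g x • v x = 0 := by
    intro g hg
    have hgi : IntegrableOn (fun x => g x • v x) (Set.Ioo (0 : ℝ) 1) := by
      have := integrable_smul (fun x => g x * (1 - x)) (by fun_prop) u
      simpa [hv, smul_smul, IntegrableOn] using this
    set N : ℝ := ∫ x in Set.Ioo (0 : ℝ) 1, ‖v x‖ with hN
    have hN0 : 0 ≤ N := integral_nonneg fun _ => norm_nonneg _
    have key : ∀ ε > 0, ‖∫ x in Set.Ioo (0 : ℝ) 1, g x • v x‖ ≤ ε * N := by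
      intro ε hε
      obtain ⟨q, hq⟩ := exists_polynomial_near_of_continuousOn 0 1 g hg.continuousOn ε hε
      have hqi : IntegrableOn (fun x => q.eval x • v x) (Set.Ioo (0 : ℝ) 1) := by
        have := integrable_smul (fun x => q.eval x * (1 - x)) (by fun_prop) u
        simpa [hv, smul_smul, IntegrableOn] using this
      have hq0 : ∫ x in Set.Ioo (0 : ℝ) 1, q.eval x • v x = 0 := by
        rw [← hI q]
        refine integral_congr_ae (Filter.Eventually.of_forall fun x => ?_)
        simp only [hv, smul_smul]
        congr 1
        ring
      have : ∫ x in Set.Ioo (0 : ℝ) 1, g x • v x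
          = ∫ x in Set.Ioo (0 : ℝ) 1, (g x • v x - q.eval x • v x) := by
        rw [integral_sub hgi hqi, hq0, sub_zero]
      rw [this, hN, ← integral_const_mul]
      refine norm_integral_le_of_norm_le (hvi.norm.const_mul ε) ?_
      refine (ae_restrict_mem measurableSet_Ioo).mono fun x hx => ?_
      rw [← sub_smul, norm_smul]
      have := (hq x (Set.Ioo_subset_Icc_self hx)).le
      rw [abs_sub_comm] at this
      exact mul_le_mul_of_nonneg_right this (norm_nonneg _)
    have : ‖∫ x in Set.Ioo (0 : ℝ) 1, g x • v x‖ ≤ 0 := by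
      refine le_of_forall_pos_le_add fun ε hε => ?_
      have h := key (ε / (N + 1)) (by positivity)
      refine h.trans ?_
      rw [zero_add, div_mul_eq_mul_div, div_le_iff₀ (by positivity)]
      nlinarith
    exact norm_le_zero_iff.mp this
  have hae : ∀ᵐ x, x ∈ Set.Ioo (0 : ℝ) 1 → v x = 0 := by
    refine isOpen_Ioo.ae_eq_zero_of_integral_contDiff_smul_eq_zero hvi.locallyIntegrableOn ?_
    intro g hg _ hsupp
    rw [← hzero g hg.continuous]
    refine (setIntegral_eq_integral_of_forall_compl_eq_zero fun x hx => ?_).symm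
    rw [image_eq_zero_of_notMem_tsupport (fun h => hx (hsupp h)), zero_smul]
  refine (Lp.eq_zero_iff_ae_eq_zero).mpr ?_
  refine (ae_restrict_iff' measurableSet_Ioo).mpr ?_
  filter_upwards [hae] with x hx hxI
  have h := hx hxI
  have h1 : (1 - x) ≠ 0 := by have := hxI.2; linarith
  exact (smul_eq_zero.mp h).resolve_left h1

variable (𝕜)

/-- The space of the coefficient vectors of the functions in `L²(0,1)`. -/
def CoeffSpace : Type _ := LinearMap.range (coeffMap (𝕜 := 𝕜))

instance : AddCommGroup (CoeffSpace 𝕜) :=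
  inferInstanceAs (AddCommGroup (LinearMap.range (coeffMap (𝕜 := 𝕜))))

instance : Module 𝕜 (CoeffSpace 𝕜) :=
  inferInstanceAs (Module 𝕜 (LinearMap.range (coeffMap (𝕜 := 𝕜))))

/-- The analysis operator and its inverse, the synthesis operator, as linear maps. -/
def analysisLin : L2I 𝕜 ≃ₗ[𝕜] CoeffSpace 𝕜 :=
  LinearEquiv.ofInjective coeffMap coeffMap_injective

/-- The norm of a coefficient vector is the norm in `L²(0,1)` of its function. -/
instance : NormedAddCommGroup (CoeffSpace 𝕜) :=
  NormedAddCommGroup.induced (CoeffSpace 𝕜) (L2I 𝕜) (analysisLin 𝕜).symm.toLinearMap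
    (analysisLin 𝕜).symm.injective

instance : NormedSpace 𝕜 (CoeffSpace 𝕜) :=
  NormedSpace.induced 𝕜 (CoeffSpace 𝕜) (L2I 𝕜) (analysisLin 𝕜).symm.toLinearMap

/-- The analysis operator `ℰ`; the synthesis operator is `ℰ.symm`. -/
def analysis : L2I 𝕜 ≃ₗᵢ[𝕜] CoeffSpace 𝕜 where
  toLinearEquiv := analysisLin 𝕜
  norm_map' u := by
    change ‖(analysisLin 𝕜).symm (analysisLin 𝕜 u)‖ = ‖u‖
    rw [LinearEquiv.symm_apply_apply]

variable {𝕜}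

/-- The underlying sequence of a coefficient vector. -/
def CoeffSpace.toSeq (c : CoeffSpace 𝕜) : ℕ → 𝕜 := Subtype.val c

lemma toSeq_analysis (u : L2I 𝕜) : (analysis 𝕜 u).toSeq = intervalCoeff u := rfl

end CoefficientSpace

end JacobiVolterra

end

open JacobiVolterra

noncomputable section

namespace JacobiVolterra

/-! ### Orthogonality of the shifted Jacobi polynomials -/

/-! Every matrix-vector product in the method is an exact identity between coefficients. For `opE`
and `opKernel` it is the bilinear Parseval identity `hasSum_parseval`. A coefficient of `u(y)` on
the triangle is, by Fubini, a pairing of `√(1-y) u` with a fixed function in `L²(0,1)`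
(`hasSum_opE`), and a coefficient of `K F` is a pairing of `K p` with `F` (`hasSum_opKernel`). The
product `K(x,y) u(y)` is only integrable, so Parseval is not available after that step, nor is it
needed. The basis functions of index `⟨m, 0⟩` do not depend on `y`, hence `opQ` just selects entries
(`opQ_eq`) and produces the unweighted integrals `∫ p_m 𝒱u`. Since `opJ` is banded, `1 - J` acts by
finite sums and turns `p_m` into `(1-x) p_m`, which restores the weight (`hasSum_opJ`,
`method_eq_volterra`). Both bases are orthonormal by Rodrigues' formula and integration by parts,
and complete by Stone–Weierstrass. Compactness is Hilbert–Schmidt: `K`, extended by zero, is square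
integrable on the unit square. On `ℓ²`, conjugation by `√(1-x)` gives the kernel `√(1-x) K(x,y) /
√(1-y)`, which is square integrable under the extra hypothesis. The coefficient maps are isometries,
so they carry compactness and the second-kind equation to coefficient space. -/

lemma integral_eval_derivative (p : ℝ[X]) :
    ∫ x in (0 : ℝ)..1, (derivative p).eval x = p.eval 1 - p.eval 0 :=
  intervalIntegral.integral_eq_sub_of_hasDerivAt (fun x _ => p.hasDerivAt x)
    ((derivative p).continuous.intervalIntegrable _ _)

/-- Repeated integration by parts, when all the boundary terms vanish. -/
lemma integral_iterate_derivative_mul (F : ℝ[X]) (n : ℕ) (q : ℝ[X])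
    (h0 : ∀ j < n, (derivative^[j] F * derivative^[n - 1 - j] q).eval 0 = 0)
    (h1 : ∀ j < n, (derivative^[j] F * derivative^[n - 1 - j] q).eval 1 = 0) :
    ∫ x in (0 : ℝ)..1, (derivative^[n] F * q).eval x
      = (-1) ^ n * ∫ x in (0 : ℝ)..1, (F * derivative^[n] q).eval x := by
  induction n generalizing q with
  | zero => simp
  | succ n ih =>
    -- The boundary terms for `n` and `derivative q` are those for `n + 1` and `q` with `j < n`. The
    -- remaining one, `j = n`, comes from the integration by parts in `hb`.
    have hstep : ∀ j < n, derivative^[n - 1 - j] (derivative q)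
        = derivative^[n + 1 - 1 - j] q := by
      intro j hj
      rw [← Function.iterate_succ_apply]
      congr 2
      omega
    have hb := integral_eval_derivative (derivative^[n] F * q)
    have hb0 := h0 n (by omega)
    have hb1 := h1 n (by omega)
    simp only [Nat.add_sub_cancel, Nat.sub_self, Function.iterate_zero, id] at hb0 hb1
    rw [hb0, hb1, derivative_mul] at hb
    simp only [eval_add] at hb
    rw [intervalIntegral.integral_add ((Polynomial.continuous _).intervalIntegrable _ _)
      ((Polynomial.continuous _).intervalIntegrable _ _),
      ih (derivative q)
        (fun j hj => by rw [hstep j hj]; exact h0 j (by omega))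
        (fun j hj => by rw [hstep j hj]; exact h1 j (by omega))] at hb
    rw [Function.iterate_succ_apply', Function.iterate_succ_apply, pow_succ]
    linarith

lemma iterate_derivative_X_sub_one_pow (m k : ℕ) :
    derivative^[k] ((X - 1 : ℝ[X]) ^ m) = C (m.descFactorial k : ℝ) * (X - 1) ^ (m - k) := by
  have := iterate_derivative_X_sub_pow m k (1 : ℝ)
  simpa [nsmul_eq_mul] using this

/-- Rodrigues' formula. -/
lemma rodrigues (a n : ℕ) :
    derivative^[n] ((X - 1 : ℝ[X]) ^ (n + a) * X ^ n)
      = C (n.factorial : ℝ) * ((X - 1) ^ a * jacobi a 0 n) := by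
  rw [iterate_derivative_mul, jacobi, Finset.mul_sum, Finset.mul_sum]
  refine Finset.sum_congr rfl fun k hk => ?_
  have hk' : k ≤ n := Nat.lt_succ_iff.mp (Finset.mem_range.mp hk)
  rw [iterate_derivative_X_sub_one_pow, iterate_derivative_X_pow_eq_C_mul, nsmul_eq_mul]
  -- In the Leibniz term the two falling factorials equal `(n-k)! C(n+a,n-k)` and `n!/(n-k)!`;
  -- extracting `n!` leaves the coefficient in `jacobi`.
  have h1 : (n + a).descFactorial (n - k) = (n - k).factorial * (n + a).choose (n - k) :=
    Nat.descFactorial_eq_factorial_mul_choose _ _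
  have h2 : (n - k).factorial * n.descFactorial k = n.factorial :=
    Nat.factorial_mul_descFactorial hk'
  have h3 : n + a - (n - k) = a + k := by omega
  rw [h3, h1, ← h2, pow_add]
  push_cast
  simp only [map_mul, map_natCast]
  ring_nf

lemma natDegree_jacobi_le (a n : ℕ) : (jacobi a 0 n).natDegree ≤ n := by
  refine natDegree_sum_le_of_forall_le _ _ fun s hs => ?_
  have hs' : s ≤ n := Nat.lt_succ_iff.mp (Finset.mem_range.mp hs)
  refine (natDegree_C_mul_le _ _).trans (natDegree_mul_le.trans ?_)
  have h1 : ((X - 1 : ℝ[X]) ^ s).natDegree ≤ s := by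
    refine natDegree_pow_le.trans ?_
    have : (X - 1 : ℝ[X]).natDegree = 1 := by simpa using natDegree_X_sub_C (1 : ℝ)
    simp [this]
  have h2 : ((X : ℝ[X]) ^ (n - s)).natDegree ≤ n - s := by simp
  omega

/-- Each product `(X - 1)^s X^(n-s)` is monic of degree `n`, so the coefficients just add up, by
Vandermonde's identity. -/
lemma coeff_jacobi (a n : ℕ) : (jacobi a 0 n).coeff n = ((2 * n + a).choose n : ℝ) := by
  have hm : ∀ s ∈ Finset.range (n + 1), ((X - 1 : ℝ[X]) ^ s * X ^ (n - s)).coeff n = 1 := by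
    intro s hs
    have hs' : s ≤ n := Nat.lt_succ_iff.mp (Finset.mem_range.mp hs)
    have h0 : (X - 1 : ℝ[X]).Monic := by simpa using monic_X_sub_C (1 : ℝ)
    have h1 : (X - 1 : ℝ[X]).natDegree = 1 := by simpa using natDegree_X_sub_C (1 : ℝ)
    have hmon : ((X - 1 : ℝ[X]) ^ s * X ^ (n - s)).Monic := (h0.pow s).mul (monic_X_pow _)
    have hdeg : ((X - 1 : ℝ[X]) ^ s * X ^ (n - s)).natDegree = n := by
      rw [(h0.pow s).natDegree_mul (monic_X_pow _), h0.natDegree_pow, h1, natDegree_X_pow]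
      omega
    simpa [Monic, leadingCoeff, hdeg] using hmon
  have hV : (2 * n + a).choose n
      = ∑ s ∈ Finset.range (n + 1), (n + a).choose (n - s) * (n + 0).choose s := by
    rw [show 2 * n + a = n + (n + a) by ring, Nat.add_choose_eq,
      Finset.Nat.sum_antidiagonal_eq_sum_range_succ (fun i j => n.choose i * (n + a).choose j)]
    exact Finset.sum_congr rfl fun s _ => mul_comm _ _
  rw [hV, jacobi, finsetSum_coeff]
  push_cast
  refine Finset.sum_congr rfl fun s hs => ?_
  rw [coeff_C_mul, hm s hs, mul_one]

lemma degree_jacobi (a n : ℕ) : (jacobi a 0 n).degree = n := by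
  refine degree_eq_of_le_of_coeff_ne_zero
    (natDegree_le_iff_degree_le.mp (natDegree_jacobi_le a n)) ?_
  rw [coeff_jacobi]
  exact_mod_cast (Nat.choose_pos (by omega)).ne'

lemma iterate_derivative_jacobi (a n : ℕ) :
    derivative^[n] (jacobi a 0 n) = C ((n.factorial * (2 * n + a).choose n : ℕ) : ℝ) := by
  have hdeg : (derivative^[n] (jacobi a 0 n)).natDegree = 0 := by
    have := natDegree_iterate_derivative (jacobi a 0 n) n
    have := natDegree_jacobi_le a n
    omega
  rw [eq_C_of_natDegree_eq_zero hdeg, coeff_iterate_derivative, zero_add, coeff_jacobi,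
    Nat.descFactorial_self]
  simp

lemma eval_iterate_derivative_eq_zero {q p : ℝ[X]} {n j : ℕ} (hd : q ^ n ∣ p) (hj : j < n)
    {x : ℝ} (hx : q.eval x = 0) : (derivative^[j] p).eval x = 0 := by
  obtain ⟨r, hr⟩ := pow_sub_dvd_iterate_derivative_of_pow_dvd j hd
  rw [hr, eval_mul, eval_pow, hx, zero_pow (by omega), zero_mul]

/-- Rodrigues' formula followed by `n` integrations by parts. The zeros of order `n` at `0` and `n +
a` at `1` remove all boundary terms. Taking `q` of degree below `n` gives orthogonality; taking `q`
the Jacobi polynomial gives its norm. -/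
lemma integral_rodrigues_mul (a n : ℕ) (q : ℝ[X]) :
    (n.factorial : ℝ) * ∫ x in (0 : ℝ)..1, ((X - 1 : ℝ[X]) ^ a * jacobi a 0 n * q).eval x
      = (-1) ^ n * ∫ x in (0 : ℝ)..1,
          ((X - 1 : ℝ[X]) ^ (n + a) * X ^ n * derivative^[n] q).eval x := by
  rw [← integral_iterate_derivative_mul, rodrigues, ← intervalIntegral.integral_const_mul]
  · congr 1
    funext x
    simp only [eval_mul, eval_C, mul_assoc]
  · intro j hj
    rw [eval_mul, eval_iterate_derivative_eq_zero (q := X) (n := n) (dvd_mul_left _ _) hj (by simp),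
      zero_mul]
  · intro j hj
    rw [eval_mul, eval_iterate_derivative_eq_zero (q := X - 1) (n := n + a) (dvd_mul_right _ _)
      (by omega) (by simp), zero_mul]

/-- A Beta integral: up to a constant, `(X - 1)^(n+a)` is the `n`-th derivative of `(X - 1)^(2n+a)`,
and integration by parts moves these derivatives onto `X^n`. -/
lemma integral_X_sub_one_pow_mul_X_pow (a n : ℕ) :
    ((2 * n + a + 1).factorial : ℝ) * ∫ x in (0 : ℝ)..1, ((X - 1 : ℝ[X]) ^ (n + a) * X ^ n).eval x
      = (-1) ^ (n + a) * ((n + a).factorial * n.factorial : ℕ) := by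
  have h := integral_iterate_derivative_mul ((X - 1 : ℝ[X]) ^ (2 * n + a)) n (X ^ n) ?_ ?_
  · have hd : (2 * n + a).descFactorial n * (n + a).factorial = (2 * n + a).factorial := by
      have := Nat.factorial_mul_descFactorial (n := 2 * n + a) (k := n) (by omega)
      rw [show 2 * n + a - n = n + a by omega] at this
      rw [mul_comm, this]
    rw [iterate_derivative_X_sub_one_pow, iterate_derivative_X_pow_eq_C_mul, Nat.sub_self,
      Nat.descFactorial_self, show 2 * n + a - n = n + a by omega] at h
    simp only [mul_assoc] at h
    have e1 : ∀ (c : ℝ) (p : ℝ[X]), ∫ x in (0 : ℝ)..1, (C c * p).eval x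
        = c * ∫ x in (0 : ℝ)..1, p.eval x := by
      intro c p
      simp only [eval_mul, eval_C, intervalIntegral.integral_const_mul]
    have e2 : ∫ x in (0 : ℝ)..1, ((X - 1 : ℝ[X]) ^ (2 * n + a)).eval x
        = (-1) ^ (2 * n + a) / (2 * n + a + 1) := by
      have := integral_eval_derivative ((X - 1 : ℝ[X]) ^ (2 * n + a + 1))
      have hder : derivative ((X - 1 : ℝ[X]) ^ (2 * n + a + 1))
          = C ((2 * n + a + 1 : ℕ) : ℝ) * (X - 1) ^ (2 * n + a) := by
        have := iterate_derivative_X_sub_one_pow (2 * n + a + 1) 1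
        simpa using this
      rw [hder, e1] at this
      simp only [eval_pow, eval_sub, eval_X, eval_one, sub_self, zero_sub] at this
      rw [zero_pow (by omega), pow_succ] at this
      rw [eq_div_iff (by positivity), mul_comm]
      push_cast at this
      simp only [eval_pow, eval_sub, eval_X, eval_one]
      linarith
    have e3 : ((X - 1 : ℝ[X]) ^ (2 * n + a) * (C (n.factorial : ℝ) * X ^ 0))
        = C (n.factorial : ℝ) * (X - 1) ^ (2 * n + a) := by ring
    rw [e1, e3, e1, e2] at h
    rw [Nat.factorial_succ, ← hd]
    push_cast
    set I := ∫ x in (0 : ℝ)..1, ((X - 1 : ℝ[X]) ^ (n + a) * X ^ n).eval x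
    have hs : ((-1 : ℝ)) ^ n * (-1) ^ (2 * n + a) = (-1) ^ (n + a) := by
      rw [pow_add, pow_mul, pow_add]; norm_num
    calc _ = (2 * n + a + 1) * (n + a).factorial * (((2 * n + a).descFactorial n : ℝ) * I) := by
            ring
      _ = (-1 : ℝ) ^ n * (-1) ^ (2 * n + a) * ((n + a).factorial * n.factorial) := by
            rw [h]
            field_simp
      _ = _ := by rw [hs]
  · intro j hj
    rw [eval_mul, eval_iterate_derivative_eq_zero (q := X) (n := n) (p := X ^ n) dvd_rfl (by omega)
      (by simp), mul_zero]
  · intro j hj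
    rw [eval_mul, eval_iterate_derivative_eq_zero (q := X - 1) (n := 2 * n + a) dvd_rfl (by omega)
      (by simp), zero_mul]

/-- The `n`-th derivative of the second factor is a constant, so only the Beta integral remains. The
sign comes from the weight `(X - 1)^a` in place of `(1 - X)^a`. -/
lemma integral_jacobi_sq (a n : ℕ) :
    ∫ x in (0 : ℝ)..1, ((X - 1 : ℝ[X]) ^ a * jacobi a 0 n * jacobi a 0 n).eval x
      = (-1) ^ a / (2 * n + a + 1) := by
  have h := integral_rodrigues_mul a n (jacobi a 0 n)
  rw [iterate_derivative_jacobi] at h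
  have hB := integral_X_sub_one_pow_mul_X_pow a n
  have hc : (2 * n + a).choose n * n.factorial * (n + a).factorial = (2 * n + a).factorial := by
    have := Nat.choose_mul_factorial_mul_factorial (n := 2 * n + a) (k := n) (by omega)
    rwa [show 2 * n + a - n = n + a by omega] at this
  simp only [eval_mul, eval_C, intervalIntegral.integral_mul_const] at h hB ⊢
  rw [Nat.factorial_succ, ← hc] at hB
  set I := ∫ x in (0 : ℝ)..1, ((X - 1 : ℝ[X]) ^ (n + a)).eval x * (X ^ n : ℝ[X]).eval x
  set J := ∫ x in (0 : ℝ)..1, ((X - 1 : ℝ[X]) ^ a).eval x * (jacobi a 0 n).eval x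
    * (jacobi a 0 n).eval x
  push_cast at h hB
  have f1 : (n.factorial : ℝ) ≠ 0 := by positivity
  have f2 : ((n + a).factorial : ℝ) ≠ 0 := by positivity
  rw [eq_div_iff (by positivity)]
  have hs : (-1 : ℝ) ^ n * (-1) ^ (n + a) = (-1) ^ a := by
    rw [pow_add, ← mul_assoc, ← mul_pow]; norm_num
  have hI : (2 * n + a + 1 : ℝ) * ((2 * n + a).choose n * I) = (-1) ^ (n + a) := by
    apply mul_right_cancel₀ (mul_ne_zero f2 f1)
    rw [← hB]; ring
  have hJ : J = (-1) ^ n * ((2 * n + a).choose n * I) := by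
    apply mul_left_cancel₀ f1
    rw [h]; ring
  rw [hJ, ← hs, ← hI]
  ring

lemma integral_jacobi_mul_of_lt (a : ℕ) {m n : ℕ} (h : m < n) :
    ∫ x in (0 : ℝ)..1, ((X - 1 : ℝ[X]) ^ a * jacobi a 0 n * jacobi a 0 m).eval x = 0 := by
  have h' := integral_rodrigues_mul a n (jacobi a 0 m)
  rw [iterate_derivative_eq_zero ((natDegree_jacobi_le a m).trans_lt h)] at h'
  simpa [Nat.factorial_ne_zero] using h'

lemma setIntegral_Ioo_eq (f : ℝ → ℝ) : ∫ x in Set.Ioo (0 : ℝ) 1, f x = ∫ x in (0 : ℝ)..1, f x := by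
  rw [intervalIntegral.integral_of_le zero_le_one, integral_Ioc_eq_integral_Ioo]

/-- The shifted Jacobi polynomials are orthogonal for the weight `(1 - x)^a`. -/
lemma integral_jacobi_mul_jacobi (a n m : ℕ) :
    ∫ x in Set.Ioo (0 : ℝ) 1, (1 - x) ^ a * (jacobi a 0 n).eval x * (jacobi a 0 m).eval x
      = if n = m then 1 / (2 * n + a + 1 : ℝ) else 0 := by
  have key : ∫ x in Set.Ioo (0 : ℝ) 1, (1 - x) ^ a * (jacobi a 0 n).eval x * (jacobi a 0 m).eval x
      = (-1) ^ a * ∫ x in (0 : ℝ)..1, ((X - 1 : ℝ[X]) ^ a * jacobi a 0 n * jacobi a 0 m).eval x := by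
    rw [setIntegral_Ioo_eq, ← intervalIntegral.integral_const_mul]
    congr 1
    funext x
    simp only [eval_mul, eval_pow, eval_sub, eval_X, eval_one]
    rw [show 1 - x = -1 * (x - 1) by ring, mul_pow]
    ring
  rw [key]
  split_ifs with h
  · subst h
    rw [integral_jacobi_sq, mul_div_assoc', ← mul_pow]
    norm_num
  · rcases lt_or_gt_of_ne h with h | h
    · rw [mul_right_comm, integral_jacobi_mul_of_lt a h, mul_zero]
    · rw [integral_jacobi_mul_of_lt a h, mul_zero]

/-- Every polynomial is a combination of the Jacobi polynomials up to its degree. -/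
lemma exists_sum_jacobi (a : ℕ) (q : ℝ[X]) :
    ∃ c : ℕ → ℝ, q = ∑ n ∈ Finset.range (q.natDegree + 1), C (c n) * jacobi a 0 n := by
  let S : Polynomial.Sequence ℝ := ⟨jacobi a 0, degree_jacobi a⟩
  have hq : q ∈ Submodule.span ℝ (S '' Set.Iic q.natDegree) := by
    rw [S.span_degreeLE fun i _ => (leadingCoeff_ne_zero.mpr (S.ne_zero i)).isUnit]
    exact mem_degreeLE.mpr degree_le_natDegree
  obtain ⟨c, hcs, hc⟩ := (Finsupp.mem_span_image_iff_linearCombination ℝ).mp hq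
  refine ⟨c, ?_⟩
  conv_lhs => rw [← hc, Finsupp.linearCombination_apply, Finsupp.sum]
  simp only [smul_eq_C_mul]
  refine Finset.sum_subset (fun i hi => ?_) fun i _ hi => ?_
  · exact Finset.mem_range.mpr (Nat.lt_succ_of_le (hcs hi))
  · rw [Finsupp.notMem_support_iff.mp hi]; simp

/-! ### Complete orthonormal families of real functions -/

section Complete

variable {𝕜 : Type*} [RCLike 𝕜]

/-- A function on a compact set is zero when its integral against every function in a separating
algebra of continuous functions vanishes. -/
lemma ae_eq_zero_of_integral_subalgebra {E : Type*} [NormedAddCommGroup E] [NormedSpace ℝ E]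
    [FiniteDimensional ℝ E] [MeasurableSpace E] [BorelSpace E] {μ : Measure E} {S : Set E}
    (hS : IsCompact S) (hμ : ∀ᵐ x ∂μ, x ∈ S) {A : Subalgebra ℝ C(E, ℝ)} (hA : A.SeparatesPoints)
    {f : E → 𝕜} (hf : Integrable f μ) (h : ∀ g ∈ A, ∫ x, g x • f x ∂μ = 0) : f =ᵐ[μ] 0 := by
  have hint : ∀ g : C(E, ℝ), Integrable (fun x => g x • f x) μ := by
    intro g
    obtain ⟨B, hB⟩ := hS.exists_bound_of_continuousOn g.continuous.continuousOn
    exact hf.bdd_smul B g.continuous.aestronglyMeasurable (hμ.mono fun x hx => hB x hx)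
  refine ae_eq_zero_of_integral_contDiff_smul_eq_zero hf.locallyIntegrable fun g hg _ => ?_
  let G : C(E, ℝ) := ⟨g, hg.continuous⟩
  set N : ℝ := ∫ x, ‖f x‖ ∂μ with hN
  have hN0 : 0 ≤ N := integral_nonneg fun _ => norm_nonneg _
  have key : ∀ ε > 0, ‖∫ x, G x • f x ∂μ‖ ≤ ε * N := by
    intro ε hε
    -- Stone–Weierstrass approximates the test function uniformly on `S` only, which suffices
    -- because `μ` is carried by `S`.
    obtain ⟨q, hqA, hq⟩ :=
      ContinuousMap.exists_mem_subalgebra_near_continuous_of_isCompact_of_separatesPoints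
        hA G hS hε
    have : ∫ x, G x • f x ∂μ = ∫ x, (G x • f x - q x • f x) ∂μ := by
      rw [integral_sub (hint G) (hint q), h q hqA, sub_zero]
    rw [this, hN, ← integral_const_mul]
    refine norm_integral_le_of_norm_le (hf.norm.const_mul ε) (hμ.mono fun x hx => ?_)
    rw [← sub_smul, norm_smul]
    have := (hq x hx).le
    rw [norm_sub_rev] at this
    exact mul_le_mul_of_nonneg_right this (norm_nonneg _)
  refine norm_le_zero_iff.mp (le_of_forall_pos_le_add fun ε hε => ?_)
  -- The denominator is `N + 1` because `N` may be zero.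
  refine (key (ε / (N + 1)) (by positivity)).trans ?_
  rw [zero_add, div_mul_eq_mul_div, div_le_iff₀ (by positivity)]
  nlinarith

variable {α : Type*} [MeasurableSpace α] {μ : Measure α}

lemma integral_smul_toLp (ψ : α → ℝ) {f : α → 𝕜} (hf : MemLp f 2 μ) :
    ∫ x, ψ x • hf.toLp f x ∂μ = ∫ x, ψ x • f x ∂μ :=
  integral_congr_ae (hf.coeFn_toLp.mono fun x hx => by simp only [hx])

variable {ι : Type*} [DecidableEq ι]

variable (𝕜) in
/-- The real functions `φ i` form an orthonormal basis of `L²(μ; 𝕜)`. -/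
structure IsOrthonormalBasis (φ : ι → α → ℝ) (μ : Measure α) : Prop where
  memLp : ∀ i, MemLp (φ i) 2 μ
  integral_mul : ∀ i j, ∫ x, φ i x * φ j x ∂μ = if i = j then 1 else 0
  complete : ∀ f : α → 𝕜, MemLp f 2 μ → (∀ i, ∫ x, φ i x • f x ∂μ = 0) → f =ᵐ[μ] 0

namespace IsOrthonormalBasis

variable {φ : ι → α → ℝ}

lemma memLp_ofReal (hφ : IsOrthonormalBasis 𝕜 φ μ) (i : ι) :
    MemLp (fun x => ((φ i x : ℝ) : 𝕜)) 2 μ := (hφ.memLp i).ofReal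

variable (hφ : IsOrthonormalBasis 𝕜 φ μ)

/-- The basis functions as elements of `L²`. -/
def vec (i : ι) : Lp 𝕜 2 μ := (hφ.memLp_ofReal i).toLp _

/-- As `φ i` is real, the conjugation in the inner product disappears. -/
lemma inner_vec (i : ι) (f : Lp 𝕜 2 μ) : inner 𝕜 (hφ.vec i) f = ∫ x, φ i x • f x ∂μ := by
  rw [L2.inner_def]
  refine integral_congr_ae ?_
  filter_upwards [(hφ.memLp_ofReal i).coeFn_toLp] with x hx
  rw [vec, hx, RCLike.inner_apply, RCLike.conj_ofReal, RCLike.real_smul_eq_coe_mul, mul_comm]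

lemma orthonormal_vec : Orthonormal 𝕜 hφ.vec := by
  rw [orthonormal_iff_ite]
  intro i j
  rw [hφ.inner_vec]
  have : ∫ x, φ i x • (hφ.vec j) x ∂μ = ∫ x, ((φ i x * φ j x : ℝ) : 𝕜) ∂μ := by
    refine integral_congr_ae ?_
    filter_upwards [(hφ.memLp_ofReal j).coeFn_toLp] with x hx
    rw [vec, hx, RCLike.real_smul_eq_coe_mul, RCLike.ofReal_mul]
  rw [this, integral_ofReal, hφ.integral_mul]
  split_ifs <;> simp

lemma eq_zero_of_inner (f : Lp 𝕜 2 μ) (h : ∀ i, inner 𝕜 (hφ.vec i) f = 0) : f = 0 := by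
  refine (Lp.eq_zero_iff_ae_eq_zero).mpr (hφ.complete f (Lp.memLp f) fun i => ?_)
  rw [← hφ.inner_vec, h i]

/-- The corresponding Hilbert basis. -/
def hilbertBasis : HilbertBasis ι 𝕜 (Lp 𝕜 2 μ) :=
  HilbertBasis.mkOfOrthogonalEqBot hφ.orthonormal_vec <| by
    refine (Submodule.eq_bot_iff _).mpr fun f hf => hφ.eq_zero_of_inner f fun i => ?_
    exact (Submodule.mem_orthogonal _ _).mp hf _ (Submodule.subset_span ⟨i, rfl⟩)

lemma hilbertBasis_apply (i : ι) : hφ.hilbertBasis i = hφ.vec i := by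
  simp [hilbertBasis]

lemma repr_apply (f : Lp 𝕜 2 μ) (i : ι) :
    hφ.hilbertBasis.repr f i = ∫ x, φ i x • f x ∂μ := by
  rw [HilbertBasis.repr_apply_apply, hilbertBasis_apply, inner_vec]

/-- Parseval's identity, in its bilinear form. -/
lemma hasSum_parseval (hφ : IsOrthonormalBasis 𝕜 φ μ) {f g : α → 𝕜}
    (hf : MemLp f 2 μ) (hg : MemLp g 2 μ) :
    HasSum (fun i => (∫ x, φ i x • f x ∂μ) * ∫ x, φ i x • g x ∂μ) (∫ x, f x * g x ∂μ) := by
  -- The pairing `∫ f g` has no conjugate, so it is the inner product of `star f` with `g`.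
  have hf' : MemLp (fun x => star (f x)) 2 μ := hf.star
  have h := hφ.hilbertBasis.hasSum_inner_mul_inner (hf'.toLp _) (hg.toLp _)
  convert h using 1
  · funext i
    rw [hilbertBasis_apply, inner_vec, ← inner_conj_symm, inner_vec, integral_smul_toLp,
      integral_smul_toLp, ← integral_conj]
    congr 2
    funext x
    rw [RCLike.real_smul_eq_coe_mul, RCLike.real_smul_eq_coe_mul, map_mul, RCLike.conj_ofReal]
    simp
  · rw [L2.inner_def]
    refine integral_congr_ae ?_
    filter_upwards [hf'.coeFn_toLp, hg.coeFn_toLp] with x h1 h2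
    rw [h1, h2, RCLike.inner_apply]
    simp [mul_comm]

end IsOrthonormalBasis

end Complete

/-! ### Hilbert–Schmidt operators -/

section HilbertSchmidt

variable {𝕜 : Type*} [RCLike 𝕜]

/-- A rank-one operator factors through the scalar field, where closed balls are compact. -/
lemma isCompactOperator_smulRight {H H' : Type*} [NormedAddCommGroup H] [NormedSpace 𝕜 H]
    [NormedAddCommGroup H'] [NormedSpace 𝕜 H'] (ℓ : H →L[𝕜] 𝕜) (w : H') :
    IsCompactOperator (ℓ.smulRight w) := by
  have hid : IsCompactOperator (id : 𝕜 → 𝕜) :=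
    ⟨Metric.closedBall 0 1, isCompact_closedBall _ _, Metric.closedBall_mem_nhds _ one_pos⟩
  exact (hid.comp_clm ℓ).clm_comp (ContinuousLinearMap.toSpanSingleton 𝕜 w)

/-- A bounded operator with `∑ ‖T b_i‖² < ∞` for a Hilbert basis `b` is compact. -/
lemma isCompactOperator_of_summable_norm_sq {ι H H' : Type*} [NormedAddCommGroup H]
    [InnerProductSpace 𝕜 H] [NormedAddCommGroup H'] [NormedSpace 𝕜 H'] [CompleteSpace H']
    (b : HilbertBasis ι 𝕜 H) (T : H →L[𝕜] H') (h : Summable fun i => ‖T (b i)‖ ^ 2) :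
    IsCompactOperator T := by
  classical
  have hcl : IsClosed {S : H →L[𝕜] H' | IsCompactOperator S} := isClosed_setOfPred_isCompactOperator
  suffices hT : T ∈ closure {S : H →L[𝕜] H' | IsCompactOperator S} by
    rwa [hcl.closure_eq] at hT
  refine Metric.mem_closure_iff.mpr fun ε hε => ?_
  obtain ⟨s, hs⟩ := summable_iff_vanishing_norm.mp h ((ε / 2) ^ 2) (by positivity)
  -- The approximant is `T` truncated to the `b i` with `i ∈ s`. Cauchy–Schwarz, the tail bound on
  -- `‖T (b i)‖²` and Bessel's inequality bound the remainder by `ε / 2`.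
  refine ⟨∑ i ∈ s, (innerSL 𝕜 (b i)).smulRight (T (b i)), ?_, ?_⟩
  · exact sum_mem (S := compactOperator (RingHom.id 𝕜) H H') fun i _ =>
      isCompactOperator_smulRight _ _
  rw [dist_eq_norm]
  refine lt_of_le_of_lt (ContinuousLinearMap.opNorm_le_bound _ (half_pos hε).le fun u => ?_)
    (half_lt_self hε)
  have hsum : HasSum (fun i => inner 𝕜 (b i) u • T (b i)) (T u) := by
    have := (b.hasSum_repr u).mapL T
    simpa [HilbertBasis.repr_apply_apply] using this
  have hlim := (hsum.sub_const (∑ i ∈ s, inner 𝕜 (b i) u • T (b i))).norm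
  have hTu : (T - ∑ i ∈ s, (innerSL 𝕜 (b i)).smulRight (T (b i))) u
      = T u - ∑ i ∈ s, inner 𝕜 (b i) u • T (b i) := by
    simp
  rw [hTu]
  refine le_of_tendsto hlim ((Filter.eventually_ge_atTop s).mono fun t hst => ?_)
  rw [← Finset.sum_sdiff hst, add_sub_cancel_right]
  have hT2 : ∑ i ∈ t \ s, ‖T (b i)‖ ^ 2 ≤ (ε / 2) ^ 2 := by
    have := (hs (t \ s) Finset.sdiff_disjoint).le
    rwa [Real.norm_of_nonneg (Finset.sum_nonneg fun _ _ => by positivity)] at this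
  have hb2 : ∑ i ∈ t \ s, ‖inner 𝕜 (b i) u‖ ^ 2 ≤ ‖u‖ ^ 2 :=
    b.orthonormal.sum_inner_products_le u
  calc ‖∑ i ∈ t \ s, inner 𝕜 (b i) u • T (b i)‖
      ≤ ∑ i ∈ t \ s, ‖T (b i)‖ * ‖inner 𝕜 (b i) u‖ :=
        norm_sum_le_of_le _ fun i _ => by rw [norm_smul, mul_comm]
    _ ≤ √(∑ i ∈ t \ s, ‖T (b i)‖ ^ 2) * √(∑ i ∈ t \ s, ‖inner 𝕜 (b i) u‖ ^ 2) :=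
        Real.sum_mul_le_sqrt_mul_sqrt _ _ _
    _ ≤ ε / 2 * ‖u‖ := by
        gcongr
        · exact Real.sqrt_le_iff.mpr ⟨by positivity, hT2⟩
        · exact Real.sqrt_le_iff.mpr ⟨by positivity, hb2⟩

variable {α : Type*} [MeasurableSpace α] {ν : Measure α}

lemma integral_norm_sq_toLp {f : α → 𝕜} (hf : MemLp f 2 ν) :
    ‖hf.toLp f‖ ^ 2 = ∫ x, ‖f x‖ ^ 2 ∂ν := by
  rw [← RCLike.ofReal_inj (K := 𝕜), RCLike.ofReal_pow, ← inner_self_eq_norm_sq_to_K (𝕜 := 𝕜),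
    L2.inner_def, ← integral_ofReal]
  refine integral_congr_ae ?_
  filter_upwards [hf.coeFn_toLp] with y hy
  rw [hy, inner_self_eq_norm_sq_to_K, RCLike.ofReal_pow]

variable [SFinite ν]

/-- Almost every row of a square integrable kernel is a square integrable function. -/
lemma exists_row_vector {f : α → α → 𝕜} (hf : MemLp (fun p : α × α => f p.1 p.2) 2 (ν.prod ν)) :
    ∀ᵐ x ∂ν, ∃ w : Lp 𝕜 2 ν, ‖w‖ ^ 2 = ∫ y, ‖f x y‖ ^ 2 ∂ν ∧
      ∀ u : Lp 𝕜 2 ν, ∫ y, f x y * u y ∂ν = inner 𝕜 w u := by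
  have h2 := (memLp_two_iff_integrable_sq_norm hf.1).mp hf
  filter_upwards [h2.prod_right_ae, hf.1.prodMk_left] with x hx hxm
  have hm : MemLp (fun y => f x y) 2 ν := (memLp_two_iff_integrable_sq_norm hxm).mpr hx
  have hs : MemLp (fun y => star (f x y)) 2 ν := hm.star
  -- The row is conjugated, since `inner` is conjugate linear in its first argument.
  refine ⟨hs.toLp _, ?_, fun u => ?_⟩
  · simp only [integral_norm_sq_toLp, norm_star]
  · rw [L2.inner_def]
    refine integral_congr_ae ?_
    filter_upwards [hs.coeFn_toLp] with y hy
    rw [hy, RCLike.inner_apply]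
    simp [mul_comm]

/-- The integral operator of a square integrable kernel is a compact operator. -/
theorem exists_compact_integral_operator {f : α → α → 𝕜}
    (hf : MemLp (fun p : α × α => f p.1 p.2) 2 (ν.prod ν)) :
    ∃ W : Lp 𝕜 2 ν →L[𝕜] Lp 𝕜 2 ν,
      (∀ u, W u =ᵐ[ν] fun x => ∫ y, f x y * u y ∂ν) ∧ IsCompactOperator W := by
  have hrow := exists_row_vector hf
  have hG : Integrable (fun x => ∫ y, ‖f x y‖ ^ 2 ∂ν) ν :=
    ((memLp_two_iff_integrable_sq_norm hf.1).mp hf).integral_prod_left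
  have hmeas : ∀ u : Lp 𝕜 2 ν, AEStronglyMeasurable (fun x => ∫ y, f x y * u y ∂ν) ν := fun u =>
    (hf.1.mul (Lp.aestronglyMeasurable u).comp_snd).integral_prod_right'
  have hbound : ∀ u : Lp 𝕜 2 ν, ∀ᵐ x ∂ν,
      ‖∫ y, f x y * u y ∂ν‖ ^ 2 ≤ (∫ y, ‖f x y‖ ^ 2 ∂ν) * ‖u‖ ^ 2 := by
    intro u
    filter_upwards [hrow] with x hx
    obtain ⟨w, hw, hwu⟩ := hx
    rw [hwu u, ← hw, ← mul_pow]
    gcongr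
    exact norm_inner_le_norm _ _
  have hint : ∀ u : Lp 𝕜 2 ν, Integrable (fun x => ‖∫ y, f x y * u y ∂ν‖ ^ 2) ν := fun u =>
    (hG.mul_const (‖u‖ ^ 2)).mono' ((hmeas u).norm.pow 2) <| (hbound u).mono fun x hx => by
      rwa [Real.norm_of_nonneg (by positivity)]
  have hmem : ∀ u : Lp 𝕜 2 ν, MemLp (fun x => ∫ y, f x y * u y ∂ν) 2 ν := fun u =>
    (memLp_two_iff_integrable_sq_norm (hmeas u)).mpr (hint u)
  -- Linearity is checked at the points `x` whose row is square integrable, where the integral is an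
  -- inner product with that row.
  let W₀ : Lp 𝕜 2 ν →ₗ[𝕜] Lp 𝕜 2 ν :=
    { toFun := fun u => (hmem u).toLp _
      map_add' := fun u v => by
        rw [← MemLp.toLp_add, MemLp.toLp_eq_toLp_iff]
        filter_upwards [hrow] with x hx
        obtain ⟨w, -, hwu⟩ := hx
        simp only [Pi.add_apply, hwu]
        exact inner_add_right _ _ _
      map_smul' := fun a u => by
        rw [RingHom.id_apply, ← MemLp.toLp_const_smul, MemLp.toLp_eq_toLp_iff]
        filter_upwards [hrow] with x hx
        obtain ⟨w, -, hwu⟩ := hx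
        simp only [Pi.smul_apply, hwu]
        exact inner_smul_right _ _ _ }
  let W : Lp 𝕜 2 ν →L[𝕜] Lp 𝕜 2 ν := W₀.mkContinuous (√(∫ x, ∫ y, ‖f x y‖ ^ 2 ∂ν ∂ν)) fun u => by
    refine (sq_le_sq₀ (norm_nonneg _) (by positivity)).mp ?_
    rw [mul_pow, Real.sq_sqrt (integral_nonneg fun x => integral_nonneg fun y => by positivity),
      ← integral_mul_const]
    exact (integral_norm_sq_toLp (hmem u)).trans_le
      (integral_mono_ae (hint u) (hG.mul_const _) (hbound u))
  refine ⟨W, fun u => (hmem u).coeFn_toLp, ?_⟩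
  obtain ⟨s, b, -⟩ := exists_hilbertBasis 𝕜 (Lp 𝕜 2 ν)
  -- Pointwise in `x`, Bessel's inequality bounds `∑ |⟨w, b i⟩|²` by `‖w‖²` for the row vector `w`.
  -- Integrating over `x` bounds every finite sum of `‖W (b i)‖²` by the squared `L²` norm of the
  -- kernel.
  refine isCompactOperator_of_summable_norm_sq b W
    (summable_of_sum_le (c := ∫ x, ∫ y, ‖f x y‖ ^ 2 ∂ν ∂ν) (fun i => by positivity) fun t => ?_)
  have hW : ∀ i, ‖W (b i)‖ ^ 2 = ∫ x, ‖∫ y, f x y * b i y ∂ν‖ ^ 2 ∂ν := fun i =>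
    integral_norm_sq_toLp (hmem (b i))
  simp only [hW]
  rw [← integral_finsetSum _ fun i _ => hint (b i)]
  refine integral_mono_ae (integrable_finsetSum _ fun i _ => hint (b i)) hG ?_
  filter_upwards [hrow] with x hx
  obtain ⟨w, hw, hwu⟩ := hx
  simp only [hwu, ← hw]
  refine le_of_eq_of_le (Finset.sum_congr rfl fun i _ => ?_)
    (b.orthonormal.sum_inner_products_le w)
  rw [norm_inner_symm]

end HilbertSchmidt

/-! ### Integration on the triangle -/

/-- Lebesgue measure on `(0,1)`. -/
abbrev unitMeasure : Measure ℝ := volume.restrict (Set.Ioo (0 : ℝ) 1)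

/-- Lebesgue measure on the triangle. -/
abbrev triMeasure : Measure (ℝ × ℝ) := volume.restrict triangle

lemma ae_mem_unit : ∀ᵐ x ∂unitMeasure, x ∈ Set.Ioo (0 : ℝ) 1 := ae_restrict_mem measurableSet_Ioo

lemma isClosed_triangle : IsClosed triangle := by
  refine (isClosed_le continuous_const continuous_fst).inter
    ((isClosed_le continuous_const continuous_snd).inter
      (isClosed_le continuous_snd (continuous_const.sub continuous_fst)))

lemma measurableSet_triangle : MeasurableSet triangle := isClosed_triangle.measurableSet

lemma triangle_subset : triangle ⊆ Set.Icc (0 : ℝ) 1 ×ˢ Set.Icc (0 : ℝ) 1 := by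
  rintro ⟨x, y⟩ ⟨h1, h2, h3⟩
  dsimp only at h1 h2 h3
  exact ⟨⟨h1, by linarith⟩, ⟨h2, by linarith⟩⟩

lemma isCompact_triangle : IsCompact triangle :=
  (isCompact_Icc.prod isCompact_Icc).of_isClosed_subset isClosed_triangle triangle_subset

/-- The triangle lies in the closed unit square, which differs from the open one by a null set. This
makes Fubini for the measure on `(0,1)` applicable. -/
lemma triMeasure_eq : triMeasure = (unitMeasure.prod unitMeasure).restrict triangle := by
  have h : (Set.Ioo (0 : ℝ) 1 ×ˢ Set.Ioo (0 : ℝ) 1 : Set (ℝ × ℝ))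
      =ᵐ[(volume : Measure (ℝ × ℝ))] Set.Icc (0 : ℝ) 1 ×ˢ Set.Icc (0 : ℝ) 1 :=
    Measure.set_prod_ae_eq Ioo_ae_eq_Icc Ioo_ae_eq_Icc
  rw [Measure.prod_restrict, ← Measure.volume_eq_prod, Measure.restrict_congr_set h,
    Measure.restrict_restrict measurableSet_triangle, Set.inter_eq_left.mpr triangle_subset]

instance : IsFiniteMeasure triMeasure := by
  rw [triMeasure_eq]
  infer_instance

lemma ae_mem_triangle : ∀ᵐ p ∂triMeasure, p ∈ triangle := ae_restrict_mem measurableSet_triangle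

lemma ae_mem_unit_prod : ∀ᵐ p ∂triMeasure, p.1 ∈ Set.Ioo (0 : ℝ) 1 ∧ p.2 ∈ Set.Ioo (0 : ℝ) 1 := by
  rw [triMeasure_eq]
  refine ae_restrict_of_ae ?_
  rw [Measure.prod_restrict]
  exact ae_restrict_mem (measurableSet_Ioo.prod measurableSet_Ioo)

section Fubini

variable {E : Type*} [NormedAddCommGroup E]

lemma indicator_triangle {x : ℝ} (hx : 0 ≤ x) (F : ℝ × ℝ → E) (y : ℝ) :
    triangle.indicator F (x, y) = (Set.Icc 0 (1 - x)).indicator (fun y => F (x, y)) y := by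
  simp only [Set.indicator, triangle, Set.mem_ofPred_eq, Set.mem_Icc, hx, true_and]

lemma Ioo_inter_Icc {x : ℝ} (hx : x ∈ Set.Ioo (0 : ℝ) 1) :
    Set.Icc 0 (1 - x) ∩ Set.Ioo (0 : ℝ) 1 = Set.Ioc 0 (1 - x) := by
  ext y
  simp only [Set.mem_inter_iff, Set.mem_Icc, Set.mem_Ioo, Set.mem_Ioc]
  constructor
  · rintro ⟨⟨_, h1⟩, h2, _⟩; exact ⟨h2, h1⟩
  · rintro ⟨h1, h2⟩; exact ⟨⟨h1.le, h2⟩, h1, by linarith [hx.1]⟩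

lemma integrable_indicator_row {x : ℝ} (hx : x ∈ Set.Ioo (0 : ℝ) 1) (F : ℝ × ℝ → E) :
    Integrable (fun y => triangle.indicator F (x, y)) unitMeasure ↔
      IntervalIntegrable (fun y => F (x, y)) volume 0 (1 - x) := by
  simp only [indicator_triangle hx.1.le]
  rw [integrable_indicator_iff measurableSet_Icc, IntegrableOn,
    Measure.restrict_restrict measurableSet_Icc, Ioo_inter_Icc hx,
    intervalIntegrable_iff_integrableOn_Ioc_of_le (by linarith [hx.2])]
  rfl

lemma integrable_triMeasure_iff (F : ℝ × ℝ → E) :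
    Integrable F triMeasure ↔ Integrable (triangle.indicator F) (unitMeasure.prod unitMeasure) := by
  rw [integrable_indicator_iff measurableSet_triangle, IntegrableOn, ← triMeasure_eq]

lemma integrable_row {F : ℝ × ℝ → E} (hF : Integrable F triMeasure) :
    ∀ᵐ x ∂unitMeasure, IntervalIntegrable (fun y => F (x, y)) volume 0 (1 - x) := by
  filter_upwards [((integrable_triMeasure_iff F).mp hF).prod_right_ae, ae_mem_unit] with x hx hxI
  exact (integrable_indicator_row hxI F).mp hx

variable [NormedSpace ℝ E]

lemma integral_indicator_row {x : ℝ} (hx : x ∈ Set.Ioo (0 : ℝ) 1) (F : ℝ × ℝ → E) :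
    ∫ y, triangle.indicator F (x, y) ∂unitMeasure = ∫ y in (0 : ℝ)..(1 - x), F (x, y) := by
  simp only [indicator_triangle hx.1.le]
  rw [integral_indicator measurableSet_Icc, Measure.restrict_restrict measurableSet_Icc,
    Ioo_inter_Icc hx, intervalIntegral.integral_of_le (by linarith [hx.2])]

lemma integrable_integral_row {F : ℝ × ℝ → E} (hF : Integrable F triMeasure) :
    Integrable (fun x => ∫ y in (0 : ℝ)..(1 - x), F (x, y)) unitMeasure := by
  refine ((integrable_triMeasure_iff F).mp hF).integral_prod_left.congr ?_
  filter_upwards [ae_mem_unit] with x hx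
  exact integral_indicator_row hx F

/-- Fubini's theorem on the triangle. -/
lemma integral_triMeasure {F : ℝ × ℝ → E} (hF : Integrable F triMeasure) :
    ∫ p, F p ∂triMeasure = ∫ x, (∫ y in (0 : ℝ)..(1 - x), F (x, y)) ∂unitMeasure := by
  have h := integral_prod (triangle.indicator F) ((integrable_triMeasure_iff F).mp hF)
  rw [integral_indicator measurableSet_triangle, ← triMeasure_eq] at h
  rw [h]
  refine integral_congr_ae ?_
  filter_upwards [ae_mem_unit] with x hx
  exact integral_indicator_row hx F

/-- The triangle is symmetric in `x` and `y`, so Fubini is also available with `x` as the inner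
variable. -/
lemma measurePreserving_swap_triMeasure : MeasurePreserving Prod.swap triMeasure triMeasure := by
  have h := (Measure.measurePreserving_swap (μ := unitMeasure)
    (ν := unitMeasure)).restrict_preimage measurableSet_triangle
  have hs : Prod.swap ⁻¹' triangle = triangle := by
    ext ⟨x, y⟩
    simp only [triangle, Set.mem_preimage, Set.mem_ofPred_eq, Prod.swap]
    constructor <;> rintro ⟨h1, h2, h3⟩ <;> refine ⟨?_, ?_, ?_⟩ <;> linarith
  rwa [hs, ← triMeasure_eq] at h

lemma integral_swap_triMeasure (F : ℝ × ℝ → E) :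
    ∫ p, F p.swap ∂triMeasure = ∫ p, F p ∂triMeasure :=
  MeasurePreserving.integral_comp' (f := MeasurableEquiv.prodComm)
    measurePreserving_swap_triMeasure F

end Fubini

/-- A function of `x` alone is integrable on the triangle when it is integrable for the weight
`1 - x`. -/
lemma integrable_fst {E : Type*} [NormedAddCommGroup E] {g : ℝ → E}
    (hm : AEStronglyMeasurable g unitMeasure)
    (hg : Integrable (fun x => (1 - x) * ‖g x‖) unitMeasure) :
    Integrable (fun p : ℝ × ℝ => g p.1) triMeasure := by
  rw [integrable_triMeasure_iff, integrable_prod_iff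
    (hm.comp_fst.indicator measurableSet_triangle)]
  constructor
  · filter_upwards [ae_mem_unit] with x hx
    exact (integrable_indicator_row hx _).mpr (intervalIntegrable_const (c := g x))
  · refine hg.congr ?_
    filter_upwards [ae_mem_unit] with x hx
    simp only [norm_indicator_eq_indicator_norm]
    rw [integral_indicator_row hx]
    simp

/-- If `u` is square integrable for the weight `1 - x`, then `u(y)` is square integrable on the
triangle. -/
lemma MemWeightedL2.memLp_snd {𝕜 : Type*} [RCLike 𝕜] {u : ℝ → 𝕜} (hu : MemWeightedL2 u) :
    AEStronglyMeasurable u unitMeasure ∧ MemLp (fun p : ℝ × ℝ => u p.2) 2 triMeasure := by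
  have hm : AEStronglyMeasurable u unitMeasure := by
    have h1 : AEStronglyMeasurable (fun x => (√(1 - x))⁻¹ • √(1 - x) • u x) unitMeasure :=
      AEStronglyMeasurable.smul (Measurable.aestronglyMeasurable (by fun_prop)) hu.1
    refine h1.congr ?_
    filter_upwards [ae_mem_unit] with x hx
    rw [inv_smul_smul₀ (Real.sqrt_pos.mpr (by linarith [hx.2])).ne']
  refine ⟨hm, ?_⟩
  suffices h : MemLp (fun p : ℝ × ℝ => u p.1) 2 triMeasure from
    h.comp_measurePreserving measurePreserving_swap_triMeasure
  have hm1 : AEStronglyMeasurable (fun p : ℝ × ℝ => u p.1) triMeasure := by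
    rw [triMeasure_eq]
    exact hm.comp_fst.restrict
  refine (memLp_two_iff_integrable_sq_norm hm1).mpr
    (integrable_fst (g := fun x => ‖u x‖ ^ 2) (hm.norm.pow 2) ?_)
  refine ((memLp_two_iff_integrable_sq_norm hu.1).mp hu).congr ?_
  filter_upwards [ae_mem_unit] with x hx
  rw [norm_smul, mul_pow, Real.norm_of_nonneg (Real.sqrt_nonneg _),
    Real.sq_sqrt (by linarith [hx.2]), Real.norm_of_nonneg (by positivity)]

/-! ### The orthonormal bases -/

section Bases

variable {𝕜 : Type*} [RCLike 𝕜]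

/-- The orthonormal basis of `L²(0,1)` that corresponds to `intervalPoly`. -/
def weightedPoly (n : ℕ) (x : ℝ) : ℝ := √(1 - x) * intervalPoly n x

lemma continuous_intervalPoly (n : ℕ) : Continuous (intervalPoly n) := by
  unfold intervalPoly
  fun_prop

lemma memLp_of_continuous {f : ℝ → ℝ} (hf : Continuous f) : MemLp f 2 unitMeasure := by
  obtain ⟨C, hC⟩ := isCompact_Icc.exists_bound_of_continuousOn
    (s := Set.Icc (0 : ℝ) 1) hf.continuousOn
  exact MemLp.of_bound hf.aestronglyMeasurable C
    (ae_mem_unit.mono fun x hx => hC x (Set.Ioo_subset_Icc_self hx))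

lemma integral_intervalPoly_mul (m n : ℕ) :
    ∫ x, (1 - x) * intervalPoly m x * intervalPoly n x ∂unitMeasure = if m = n then 1 else 0 := by
  have h := integral_jacobi_mul_jacobi 1 m n
  have e : ∀ x : ℝ, (1 - x) * intervalPoly m x * intervalPoly n x
      = (√(2 * m + 2) * √(2 * n + 2)) *
        ((1 - x) ^ 1 * (jacobi 1 0 m).eval x * (jacobi 1 0 n).eval x) := by
    intro x
    simp only [intervalPoly]
    ring
  simp only [e]
  rw [integral_const_mul, h]
  split_ifs with hmn
  · subst hmn
    rw [Real.mul_self_sqrt (by positivity)]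
    push_cast
    field_simp
    ring
  · rw [mul_zero]

lemma exists_sum_intervalPoly (q : ℝ[X]) :
    ∃ c : ℕ → ℝ, ∀ x, q.eval x = ∑ n ∈ Finset.range (q.natDegree + 1), c n * intervalPoly n x := by
  obtain ⟨c, hc⟩ := exists_sum_jacobi 1 q
  refine ⟨fun n => c n / √(2 * n + 2), fun x => ?_⟩
  conv_lhs => rw [hc]
  rw [eval_finsetSum]
  refine Finset.sum_congr rfl fun n _ => ?_
  have : √(2 * n + 2 : ℝ) ≠ 0 := (Real.sqrt_pos.mpr (by positivity)).ne'
  rw [eval_mul, eval_C, intervalPoly]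
  field_simp

/-- Splitting the weight as `√(1-x) √(1-x)` moves the weighted space onto plain `L²(0,1)`. For
completeness, `√(1-x) f` is orthogonal to all polynomials, hence zero, and the weight does not
vanish on `(0,1)`. -/
lemma isOrthonormalBasis_weightedPoly : IsOrthonormalBasis 𝕜 weightedPoly unitMeasure where
  memLp n := memLp_of_continuous
    ((continuous_const.sub continuous_id).sqrt.mul (continuous_intervalPoly n))
  integral_mul m n := by
    rw [← integral_intervalPoly_mul m n]
    refine integral_congr_ae ?_
    filter_upwards [ae_mem_unit] with x hx
    have := Real.mul_self_sqrt (show 0 ≤ 1 - x by linarith [hx.2])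
    simp only [weightedPoly]
    rw [← this]
    ring_nf
    simp only [Real.sqrt_sq (Real.sqrt_nonneg _)]
  complete f hf h := by
    have hmul : ∀ g : ℝ → ℝ, Continuous g → Integrable (fun x => g x • f x) unitMeasure := by
      intro g hg
      exact ((memLp_of_continuous hg).ofReal (K := 𝕜)).integrable_mul hf |>.congr
        (Filter.Eventually.of_forall fun x => by simp [RCLike.real_smul_eq_coe_mul])
    have hI : ∀ q : ℝ[X], ∫ x, q.eval x • √(1 - x) • f x ∂unitMeasure = 0 := by
      intro q
      obtain ⟨c, hc⟩ := exists_sum_intervalPoly q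
      have e : ∀ x, q.eval x • √(1 - x) • f x
          = ∑ n ∈ Finset.range (q.natDegree + 1), c n • weightedPoly n x • f x := by
        intro x
        rw [hc x, Finset.sum_smul]
        refine Finset.sum_congr rfl fun n _ => ?_
        rw [smul_smul, smul_smul, weightedPoly]
        congr 1
        ring
      simp only [e]
      have hi : ∀ n, Integrable (fun x => c n • weightedPoly n x • f x) unitMeasure := fun n =>
        (hmul _ ((continuous_const.sub continuous_id).sqrt.mul (continuous_intervalPoly n))).smul
          (c n)
      rw [integral_finsetSum _ fun n _ => hi n]
      refine Finset.sum_eq_zero fun n _ => ?_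
      rw [integral_smul, h n, smul_zero]
    have hz := ae_eq_zero_of_integral_subalgebra (μ := unitMeasure) isCompact_Icc
      (ae_mem_unit.mono fun x hx => Set.Ioo_subset_Icc_self hx)
      (A := (toContinuousMapAlgHom (R := ℝ)).range) (f := fun x => √(1 - x) • f x) ?_
      (hmul _ (continuous_const.sub continuous_id).sqrt) ?_
    · filter_upwards [hz, ae_mem_unit] with x hx hxI
      exact (smul_eq_zero.mp hx).resolve_left (Real.sqrt_pos.mpr (by linarith [hxI.2])).ne'
    · intro x y hxy
      exact ⟨_, ⟨toContinuousMapAlgHom X, ⟨X, rfl⟩, rfl⟩, by simpa using hxy⟩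
    · rintro _ ⟨q, rfl⟩
      exact hI q

/-! #### The triangle -/

/-- The substitution `y = (1-x) z` reduces this to Legendre orthogonality and contributes the
Jacobian `1 - x`. -/
lemma integral_legendre_row (k l : ℕ) {x : ℝ} (hx : x ∈ Set.Ioo (0 : ℝ) 1) :
    ∫ y in (0 : ℝ)..(1 - x), (jacobi 0 0 k).eval (y / (1 - x)) * (jacobi 0 0 l).eval (y / (1 - x))
      = (1 - x) * if k = l then 1 / (2 * k + 1 : ℝ) else 0 := by
  have h1 : 1 - x ≠ 0 := by linarith [hx.2]
  rw [intervalIntegral.integral_comp_div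
    (fun z => (jacobi 0 0 k).eval z * (jacobi 0 0 l).eval z) h1, zero_div, div_self h1, smul_eq_mul,
    ← setIntegral_Ioo_eq]
  have h := integral_jacobi_mul_jacobi 0 k l
  simp only [pow_zero, one_mul] at h
  rw [h]
  simp

lemma measurable_trianglePoly (q : TriIndex) :
    Measurable fun p : ℝ × ℝ => trianglePoly q p.1 p.2 := by
  unfold trianglePoly
  have h : ∀ P : ℝ[X], Measurable fun x : ℝ => P.eval x := fun P => P.continuous.measurable
  exact ((((measurable_const.sub measurable_fst).pow_const _).mul
    ((h _).comp measurable_fst)).mul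
    ((h _).comp (measurable_snd.div (measurable_const.sub measurable_fst)))).const_mul _

/-- The quotient `y/(1-x)` has no continuous extension to the vertex `(1,0)`, so compactness is used
for the polynomial in `x` and `z` on the unit square. On the triangle `z = y/(1-x)` lies in `[0,1]`,
also at the vertex, where division by zero gives `0`. -/
lemma exists_bound_trianglePoly (q : TriIndex) :
    ∃ B, ∀ p ∈ triangle, ‖trianglePoly q p.1 p.2‖ ≤ B := by
  obtain ⟨B, hB⟩ := (isCompact_Icc.prod isCompact_Icc).exists_bound_of_continuousOn
    (s := Set.Icc (0 : ℝ) 1 ×ˢ Set.Icc (0 : ℝ) 1)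
    (f := fun p : ℝ × ℝ => √((2 * q.1 + 2) * (2 * q.2 + 1)) *
      ((1 - p.1) ^ (q.2 : ℕ) * (jacobi (2 * q.2 + 1) 0 (q.1 - q.2)).eval p.1 *
      (jacobi 0 0 q.2).eval p.2)) (by fun_prop)
  refine ⟨B, fun p hp => hB (p.1, p.2 / (1 - p.1)) ⟨(triangle_subset hp).1, ?_⟩⟩
  obtain ⟨h1, h2, h3⟩ := hp
  exact ⟨div_nonneg h2 (h2.trans h3), div_le_one_of_le₀ h3 (h2.trans h3)⟩

lemma memLp_trianglePoly (q : TriIndex) :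
    MemLp (fun p : ℝ × ℝ => trianglePoly q p.1 p.2) 2 triMeasure := by
  obtain ⟨B, hB⟩ := exists_bound_trianglePoly q
  exact MemLp.of_bound (measurable_trianglePoly q).aestronglyMeasurable B
    (ae_mem_triangle.mono hB)

/-- The inner integral forces equal second indices and leaves the weight `(1-x)^(2k+1)`, for which
the polynomials `jacobi (2k+1) 0` are orthogonal. The two norms `1/(2k+1)` and `1/(2n+2)` match the
scaling. -/
lemma integral_trianglePoly_mul (q r : TriIndex) :
    ∫ p, trianglePoly q p.1 p.2 * trianglePoly r p.1 p.2 ∂triMeasure = if q = r then 1 else 0 := by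
  rw [integral_triMeasure (F := fun p => trianglePoly q p.1 p.2 * trianglePoly r p.1 p.2)
    ((memLp_trianglePoly q).integrable_mul (memLp_trianglePoly r))]
  obtain ⟨n, k⟩ := q
  obtain ⟨m, l⟩ := r
  have hrow : ∀ x ∈ Set.Ioo (0 : ℝ) 1,
      ∫ y in (0 : ℝ)..(1 - x), trianglePoly ⟨n, k⟩ x y * trianglePoly ⟨m, l⟩ x y
      = (if (k : ℕ) = l then 1 / (2 * (k : ℕ) + 1 : ℝ) else 0)
        * (√((2 * n + 2) * (2 * (k : ℕ) + 1)) * √((2 * m + 2) * (2 * (l : ℕ) + 1))) *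
        ((1 - x) ^ ((k : ℕ) + l + 1) * (jacobi (2 * k + 1) 0 (n - k)).eval x *
          (jacobi (2 * l + 1) 0 (m - l)).eval x) := by
    intro x hx
    have e : ∀ y, trianglePoly ⟨n, k⟩ x y * trianglePoly ⟨m, l⟩ x y
        = (√((2 * n + 2) * (2 * (k : ℕ) + 1)) * √((2 * m + 2) * (2 * (l : ℕ) + 1)) *
          ((1 - x) ^ ((k : ℕ) + l) * (jacobi (2 * k + 1) 0 (n - k)).eval x *
            (jacobi (2 * l + 1) 0 (m - l)).eval x)) *
          ((jacobi 0 0 k).eval (y / (1 - x)) * (jacobi 0 0 l).eval (y / (1 - x))) := by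
      intro y
      simp only [trianglePoly]
      ring
    simp only [e]
    rw [intervalIntegral.integral_const_mul, integral_legendre_row _ _ hx]
    ring
  rw [integral_congr_ae (ae_mem_unit.mono hrow), integral_const_mul]
  by_cases hkl : (k : ℕ) = l
  · have h := integral_jacobi_mul_jacobi (2 * k + 1) (n - k) (m - l)
    rw [if_pos hkl, ← hkl, show (k : ℕ) + k + 1 = 2 * k + 1 by ring]
    rw [← hkl] at h
    rw [h]
    have hk := k.is_lt
    have hl := l.is_lt
    by_cases hnm : n = m
    · subst hnm
      obtain rfl : k = l := Fin.ext hkl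
      rw [if_pos rfl, if_pos rfl, Real.mul_self_sqrt (by positivity),
        Nat.cast_sub (by omega : (k : ℕ) ≤ n)]
      push_cast
      rw [show (2 * ((n : ℝ) - (k : ℕ)) + (2 * (k : ℕ) + 1) + 1) = 2 * n + 2 by ring]
      field_simp
    · rw [if_neg (by omega), if_neg (by rintro ⟨⟩; exact hnm rfl), mul_zero]
  · rw [if_neg hkl, if_neg (by rintro ⟨⟩; exact hkl rfl), zero_mul, zero_mul]

/-- Orthogonality to the basis of the triangle gives orthogonality to all monomials. -/
lemma integral_monomial_smul_eq_zero {f : ℝ × ℝ → 𝕜} (hf : Integrable f triMeasure)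
    (h : ∀ q : TriIndex, ∫ p, trianglePoly q p.1 p.2 • f p ∂triMeasure = 0) (i j : ℕ) :
    ∫ p, (p.1 ^ i * p.2 ^ j) • f p ∂triMeasure = 0 := by
  have hint : ∀ q : TriIndex, Integrable (fun p => trianglePoly q p.1 p.2 • f p) triMeasure := by
    intro q
    obtain ⟨B, hB⟩ := exists_bound_trianglePoly q
    exact hf.bdd_smul B (measurable_trianglePoly q).aestronglyMeasurable (ae_mem_triangle.mono hB)
  -- Unscaled basis functions, with `n` now the degree of the factor in `x`; the total degree is `n
  -- + k`.
  let G : ℕ → ℕ → ℝ × ℝ → ℝ := fun k n p =>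
    (1 - p.1) ^ k * (jacobi (2 * k + 1) 0 n).eval p.1 * (jacobi 0 0 k).eval (p.2 / (1 - p.1))
  have hG : ∀ k n p, G k n p = (√((2 * (n + k : ℕ) + 2) * (2 * k + 1)))⁻¹ *
      trianglePoly ⟨n + k, ⟨k, by omega⟩⟩ p.1 p.2 := by
    intro k n p
    have : √((2 * (n + k : ℕ) + 2) * (2 * k + 1) : ℝ) ≠ 0 := (Real.sqrt_pos.mpr (by positivity)).ne'
    simp only [trianglePoly, G, Nat.add_sub_cancel]
    rw [inv_mul_cancel_left₀ this]
  have hGi : ∀ (a : ℝ) k n, Integrable (fun p => a • G k n p • f p) triMeasure := by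
    intro a k n
    simp only [hG, mul_smul]
    exact ((hint _).smul (_ : ℝ)).smul a
  have hG0 : ∀ (a : ℝ) k n, ∫ p, a • G k n p • f p ∂triMeasure = 0 := by
    intro a k n
    simp only [hG, mul_smul]
    rw [integral_smul, integral_smul, h, smul_zero, smul_zero]
  -- Write `y^j = (1-x)^j z^j` with `z = y/(1-x)` and expand `z^j` in Legendre polynomials of degree
  -- `k ≤ j`. Each needs a factor `(1-x)^k`, and the rest, `x^i (1-x)^(j-k)`, is expanded in `jacobi
  -- (2k+1) 0`.
  obtain ⟨c, hc⟩ := exists_sum_jacobi 0 ((X : ℝ[X]) ^ j)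
  rw [natDegree_X_pow] at hc
  choose d hd using fun k => exists_sum_jacobi (2 * k + 1) ((X : ℝ[X]) ^ i * (1 - X) ^ (j - k))
  set D : ℕ → ℕ := fun k => ((X : ℝ[X]) ^ i * (1 - X) ^ (j - k)).natDegree + 1
  have hexp : ∀ p : ℝ × ℝ, p.1 ∈ Set.Ioo (0 : ℝ) 1 → p.1 ^ i * p.2 ^ j
      = ∑ k ∈ Finset.range (j + 1), ∑ n ∈ Finset.range (D k), (c k * d k n) * G k n p := by
    intro p hp
    have h1 : 1 - p.1 ≠ 0 := by linarith [hp.2]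
    have hy : p.2 ^ j = (1 - p.1) ^ j * (p.2 / (1 - p.1)) ^ j := by
      rw [← mul_pow, mul_div_cancel₀ _ h1]
    have hz := congrArg (Polynomial.eval (p.2 / (1 - p.1))) hc
    rw [eval_finsetSum, eval_pow, eval_X] at hz
    rw [hy, hz, Finset.mul_sum, Finset.mul_sum]
    refine Finset.sum_congr rfl fun k hk => ?_
    have hk' : k ≤ j := Nat.lt_succ_iff.mp (Finset.mem_range.mp hk)
    have hx := congrArg (Polynomial.eval p.1) (hd k)
    rw [eval_finsetSum] at hx
    simp only [eval_mul, eval_pow, eval_X, eval_sub, eval_one, eval_C] at hx ⊢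
    calc p.1 ^ i * ((1 - p.1) ^ j * (c k * (jacobi 0 0 k).eval (p.2 / (1 - p.1))))
        = (p.1 ^ i * (1 - p.1) ^ (j - k)) *
          (c k * (1 - p.1) ^ k * (jacobi 0 0 k).eval (p.2 / (1 - p.1))) := by
          rw [← Nat.sub_add_cancel hk', pow_add, Nat.add_sub_cancel]
          ring
      _ = _ := by
          rw [hx, Finset.sum_mul]
          refine Finset.sum_congr rfl fun n _ => ?_
          simp only [G]
          ring
  have : ∫ p, (p.1 ^ i * p.2 ^ j) • f p ∂triMeasure = ∫ p, ∑ k ∈ Finset.range (j + 1),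
      ∑ n ∈ Finset.range (D k), (c k * d k n) • G k n p • f p ∂triMeasure := by
    refine integral_congr_ae ?_
    filter_upwards [ae_mem_unit_prod] with p hp
    rw [hexp p hp.1, Finset.sum_smul]
    simp only [Finset.sum_smul, mul_smul]
  rw [this, integral_finsetSum _ fun k _ => integrable_finsetSum _ fun n _ => hGi _ k n]
  refine Finset.sum_eq_zero fun k _ => ?_
  rw [integral_finsetSum _ fun n _ => hGi _ k n]
  exact Finset.sum_eq_zero fun n _ => hG0 _ k n

lemma isOrthonormalBasis_trianglePoly :
    IsOrthonormalBasis 𝕜 (fun (q : TriIndex) p => trianglePoly q p.1 p.2) triMeasure where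
  memLp := memLp_trianglePoly
  integral_mul := integral_trianglePoly_mul
  complete f hf h := by
    have hfi : Integrable f triMeasure := hf.integrable (by norm_num)
    let x : C(ℝ × ℝ, ℝ) := ⟨Prod.fst, continuous_fst⟩
    let y : C(ℝ × ℝ, ℝ) := ⟨Prod.snd, continuous_snd⟩
    refine ae_eq_zero_of_integral_subalgebra isCompact_triangle ae_mem_triangle
      (A := Algebra.adjoin ℝ {x, y}) ?_ hfi fun g hg => ?_
    · intro p p' hp
      by_cases h1 : p.1 = p'.1
      · exact ⟨y, ⟨y, Algebra.subset_adjoin (by simp), rfl⟩, fun h2 => hp (Prod.ext h1 h2)⟩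
      · exact ⟨x, ⟨x, Algebra.subset_adjoin (by simp), rfl⟩, h1⟩
    · have hint : ∀ g : C(ℝ × ℝ, ℝ), Integrable (fun p => g p • f p) triMeasure := by
        intro g
        obtain ⟨B, hB⟩ := isCompact_triangle.exists_bound_of_continuousOn g.continuous.continuousOn
        exact hfi.bdd_smul B g.continuous.aestronglyMeasurable (ae_mem_triangle.mono hB)
      -- The algebra generated by the two coordinates is spanned by monomials, so linearity reduces
      -- the claim to these.
      rw [← Subalgebra.mem_toSubmodule, Algebra.adjoin_eq_span] at hg
      induction hg using Submodule.span_induction with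
      | mem g hg =>
        obtain ⟨i, j, rfl⟩ := (Submonoid.mem_closure_pair _ _ _).mp hg
        exact integral_monomial_smul_eq_zero hfi h i j
      | zero => simp
      | add g g' _ _ hg hg' =>
        simp only [ContinuousMap.add_apply, add_smul]
        rw [integral_add (hint g) (hint g'), hg, hg', add_zero]
      | smul a g _ hg =>
        simp only [ContinuousMap.smul_apply, smul_assoc]
        rw [integral_smul, hg, smul_zero]

end Bases

/-! ### The matrices of the method -/

section Method

variable {𝕜 : Type*} [RCLike 𝕜]

/-- The weighted coefficients of `u` are the plain coefficients of `√(1-x) u` in the basis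
`weightedPoly`. -/
lemma intervalCoeff_eq (u : ℝ → 𝕜) (n : ℕ) :
    intervalCoeff u n = ∫ x, weightedPoly n x • √(1 - x) • u x ∂unitMeasure := by
  refine integral_congr_ae ?_
  filter_upwards [ae_mem_unit] with x hx
  have := Real.mul_self_sqrt (show 0 ≤ 1 - x by linarith [hx.2])
  rw [smul_smul, weightedPoly, mul_right_comm, this]

lemma memWeightedL2_intervalPoly (n : ℕ) :
    MemWeightedL2 (fun x => ((intervalPoly n x : ℝ) : 𝕜)) := by
  have h := isOrthonormalBasis_weightedPoly.memLp_ofReal (𝕜 := 𝕜) n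
  refine h.ae_eq (Filter.Eventually.of_forall fun x => ?_)
  simp only [weightedPoly, RCLike.ofReal_mul, RCLike.real_smul_eq_coe_mul]

/-- These are the basis functions constant in `y`; pairing with them integrates `y` out, which is
why `opQ` is so simple. -/
lemma trianglePoly_zero (m : ℕ) (x y : ℝ) :
    trianglePoly ⟨m, 0⟩ x y = intervalPoly m x := by
  simp [trianglePoly, intervalPoly, jacobi]

lemma memLp_trianglePoly_smul (p : TriIndex) {F : ℝ × ℝ → 𝕜} (hF : MemLp F 2 triMeasure) :
    MemLp (fun z => trianglePoly p z.1 z.2 • F z) 2 triMeasure := by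
  obtain ⟨B, hB⟩ := exists_bound_trianglePoly p
  refine hF.of_le_mul (c := B) ((measurable_trianglePoly p).aestronglyMeasurable.smul hF.1) ?_
  filter_upwards [ae_mem_triangle] with z hz
  rw [norm_smul]
  exact mul_le_mul_of_nonneg_right (hB z hz) (norm_nonneg _)

lemma integrable_trianglePoly_smul (p : TriIndex) {F : ℝ × ℝ → 𝕜} (hF : Integrable F triMeasure) :
    Integrable (fun z => trianglePoly p z.1 z.2 • F z) triMeasure := by
  obtain ⟨B, hB⟩ := exists_bound_trianglePoly p
  exact hF.bdd_smul B (measurable_trianglePoly p).aestronglyMeasurable (ae_mem_triangle.mono hB)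

/-- Integration of a function of `y` against a basis function of the triangle. -/
lemma triangleCoeff_snd (p : TriIndex) {v : ℝ → 𝕜} (hv : MemWeightedL2 v) :
    triangleCoeff (fun _ y => v y) p = ∫ y, ((((√(1 - y))⁻¹ *
      ∫ x in (0 : ℝ)..(1 - y), trianglePoly p x y : ℝ) : 𝕜)) * √(1 - y) • v y ∂unitMeasure := by
  have hi := integrable_trianglePoly_smul p (hv.memLp_snd.2.integrable (by norm_num))
  have hs := measurePreserving_swap_triMeasure.integrable_comp_of_integrable hi
  -- After the swap `x` is integrated first, and `v y` leaves the inner integral. The factor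
  -- `(√(1-y))⁻¹ √(1-y)` is inserted so that `v` appears with the root of its weight.
  rw [triangleCoeff, ← integral_swap_triMeasure]
  refine (integral_triMeasure hs).trans (integral_congr_ae ?_)
  filter_upwards [ae_mem_unit] with y hy
  have : √(1 - y) ≠ 0 := (Real.sqrt_pos.mpr (by linarith [hy.2])).ne'
  simp only [Function.comp_apply, Prod.swap]
  rw [intervalIntegral.integral_smul_const, ← RCLike.real_smul_eq_coe_mul, smul_smul,
    mul_right_comm, inv_mul_cancel₀ this, one_mul]

/-- The inner integral is at most `|B| (1-y)`, by the length of its interval, and this absorbs the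
singular factor `(1-y)^(-1/2)`. -/
lemma memLp_integral_trianglePoly (p : TriIndex) :
    MemLp (fun y => ((((√(1 - y))⁻¹ *
      ∫ x in (0 : ℝ)..(1 - y), trianglePoly p x y : ℝ) : 𝕜))) 2 unitMeasure := by
  obtain ⟨B, hB⟩ := exists_bound_trianglePoly p
  have hs := measurePreserving_swap_triMeasure.integrable_comp_of_integrable
    ((memLp_trianglePoly p).integrable (by norm_num))
  have hm : AEStronglyMeasurable (fun y => ∫ x in (0 : ℝ)..(1 - y), trianglePoly p x y)
    unitMeasure := (integrable_integral_row hs).1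
  refine MemLp.ofReal
    (MemLp.of_bound ((Measurable.aestronglyMeasurable (by fun_prop)).mul hm) |B| ?_)
  filter_upwards [ae_mem_unit] with y hy
  have h0 : 0 < 1 - y := by linarith [hy.2]
  have h1 : ‖∫ x in (0 : ℝ)..(1 - y), trianglePoly p x y‖ ≤ |B| * |1 - y - 0| := by
    refine intervalIntegral.norm_integral_le_of_norm_le_const fun x hx => ?_
    rw [Set.uIoc_of_le h0.le] at hx
    exact (hB (x, y) ⟨hx.1.le, hy.1.le, by linarith [hx.2]⟩).trans (le_abs_self B)
  have hsq := Real.sqrt_pos.mpr h0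
  have hle : √(1 - y) ≤ 1 := Real.sqrt_le_one.mpr (by linarith [hy.1])
  rw [sub_zero, abs_of_pos h0, ← Real.mul_self_sqrt h0.le] at h1
  rw [norm_mul, norm_inv, Real.norm_of_nonneg hsq.le, inv_mul_le_iff₀ hsq]
  rw [Real.mul_self_sqrt h0.le] at h1
  calc _ ≤ |B| * (1 - y) := h1
    _ = √(1 - y) * (|B| * √(1 - y)) := by
      nth_rewrite 1 [← Real.mul_self_sqrt h0.le]; ring
    _ ≤ √(1 - y) * |B| := by
      gcongr
      exact mul_le_of_le_one_right (abs_nonneg _) hle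

lemma hasSum_opE {u : ℝ → 𝕜} (hu : MemWeightedL2 u) (p : TriIndex) :
    HasSum (fun n => opE 𝕜 p n * intervalCoeff u n) (triangleCoeff (fun _ y => u y) p) := by
  rw [triangleCoeff_snd p hu]
  convert isOrthonormalBasis_weightedPoly.hasSum_parseval (memLp_integral_trianglePoly p) hu
    using 2 with n
  rw [intervalCoeff_eq u n, opE, triangleCoeff_snd p (memWeightedL2_intervalPoly n)]
  congr 1
  refine integral_congr_ae (Filter.Eventually.of_forall fun y => ?_)
  simp only [weightedPoly, RCLike.real_smul_eq_coe_mul, RCLike.ofReal_mul]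
  ring

/-- Parseval for the pair `K p` and `F`. Bounded `p` keeps `K p` in `L²`; the product `K F` itself
need not be square integrable. -/
lemma hasSum_opKernel {K : ℝ → ℝ → 𝕜}
    (hK : MemLp (fun p : ℝ × ℝ => K p.1 p.2) 2 triMeasure) {F : ℝ → ℝ → 𝕜}
    (hF : MemLp (fun p : ℝ × ℝ => F p.1 p.2) 2 triMeasure) (p : TriIndex) :
    HasSum (fun q => opKernel K p q * triangleCoeff F q)
      (triangleCoeff (fun x y => K x y * F x y) p) := by
  convert isOrthonormalBasis_trianglePoly.hasSum_parseval (memLp_trianglePoly_smul p hK) hF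
    using 2 with q
  · congr 1
    refine integral_congr_ae (Filter.Eventually.of_forall fun z => ?_)
    simp only [RCLike.real_smul_eq_coe_mul]
    ring
  · simp only [triangleCoeff, smul_mul_assoc]

lemma triangleCoeff_zero {F : ℝ → ℝ → 𝕜}
    (hF : Integrable (fun p : ℝ × ℝ => F p.1 p.2) triMeasure) (m : ℕ) :
    triangleCoeff F ⟨m, 0⟩
      = ∫ x, intervalPoly m x • (∫ y in (0 : ℝ)..(1 - x), F x y) ∂unitMeasure := by
  refine (integral_triMeasure (integrable_trianglePoly_smul ⟨m, 0⟩ hF)).trans ?_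
  simp only [trianglePoly_zero, intervalIntegral.integral_smul]

/-- The weight in `intervalCoeff` cancels the split-off `(1-x)⁻¹`, which leaves the inner product of
two basis functions of the triangle. -/
lemma opQ_eq (m : ℕ) (q : TriIndex) : opQ 𝕜 m q = if (⟨m, 0⟩ : TriIndex) = q then 1 else 0 := by
  have h := integral_trianglePoly_mul ⟨m, 0⟩ q
  have h2 := triangleCoeff_zero (F := trianglePoly q)
    ((memLp_trianglePoly q).integrable (by norm_num)) m
  have h3 : opQ 𝕜 m q = ((triangleCoeff (trianglePoly q) ⟨m, 0⟩ : ℝ) : 𝕜) := by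
    rw [h2, ← integral_ofReal]
    refine integral_congr_ae ?_
    filter_upwards [ae_mem_unit] with x hx
    have : 1 - x ≠ 0 := by linarith [hx.2]
    rw [RCLike.real_smul_eq_coe_mul, ← RCLike.ofReal_mul, mul_comm (1 - x), mul_assoc,
      mul_inv_cancel_left₀ this, smul_eq_mul]
  rw [h3, triangleCoeff]
  simp only [smul_eq_mul, h]
  split_ifs <;> simp

/-- Only one term is nonzero, so no decay of `d` is required. This matters because `d` will hold the
coefficients of a merely integrable function. -/
lemma hasSum_opQ (d : TriIndex → 𝕜) (m : ℕ) : HasSum (fun q => opQ 𝕜 m q * d q) (d ⟨m, 0⟩) := by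
  have h := hasSum_single (f := fun q => opQ 𝕜 m q * d q) (⟨m, 0⟩ : TriIndex) fun q hq => by
    rw [opQ_eq, if_neg (Ne.symm hq), zero_mul]
  simpa only [opQ_eq, if_true, one_mul] using h

lemma integrable_smul_unit {g : ℝ → ℝ} (hg : Continuous g) {w : ℝ → 𝕜}
    (hw : Integrable w unitMeasure) : Integrable (fun x => g x • w x) unitMeasure := by
  obtain ⟨B, hB⟩ := isCompact_Icc.exists_bound_of_continuousOn
    (s := Set.Icc (0 : ℝ) 1) hg.continuousOn
  exact hw.bdd_smul B hg.aestronglyMeasurable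
    (ae_mem_unit.mono fun x hx => hB x (Set.Ioo_subset_Icc_self hx))

/-- `J` is a banded matrix: the series with it are finite sums. -/
lemma hasSum_opJ {w : ℝ → 𝕜} (hw : Integrable w unitMeasure) (m : ℕ) :
    HasSum (fun n => opJ 𝕜 m n * ∫ x, intervalPoly n x • w x ∂unitMeasure)
      (∫ x, (x * intervalPoly m x) • w x ∂unitMeasure) := by
  obtain ⟨a, ha⟩ := exists_sum_intervalPoly (X * (C √(2 * m + 2) * jacobi 1 0 m))
  set N := (X * (C √(2 * m + 2) * jacobi 1 0 m)).natDegree + 1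
  have ha' : ∀ x, x * intervalPoly m x = ∑ n ∈ Finset.range N, a n * intervalPoly n x := by
    intro x
    rw [← ha x]
    simp [intervalPoly]
  -- Multiplication by `x` is symmetric, so row `m` of `opJ` lists the finitely many coefficients of
  -- `x p_m`.
  have hJ : ∀ n, opJ 𝕜 m n = if n ∈ Finset.range N then ((a n : ℝ) : 𝕜) else 0 := by
    intro n
    have h1 : opJ 𝕜 m n
        = ((∫ x, (x * intervalPoly m x) * ((1 - x) * intervalPoly n x) ∂unitMeasure : ℝ) : 𝕜) := by
      rw [← integral_ofReal]
      refine integral_congr_ae (Filter.Eventually.of_forall fun x => ?_)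
      simp only [RCLike.real_smul_eq_coe_mul, ← RCLike.ofReal_mul]
      congr 1
      ring
    have h2 : ∀ x, (x * intervalPoly m x) * ((1 - x) * intervalPoly n x)
        = ∑ l ∈ Finset.range N, a l * ((1 - x) * intervalPoly l x * intervalPoly n x) := by
      intro x
      rw [ha' x, Finset.sum_mul]
      exact Finset.sum_congr rfl fun l _ => by ring
    have hi : ∀ l, Integrable
        (fun x => a l * ((1 - x) * intervalPoly l x * intervalPoly n x)) unitMeasure := fun l =>
      (memLp_of_continuous (continuous_const.mul (((continuous_const.sub continuous_id).mul
        (continuous_intervalPoly l)).mul (continuous_intervalPoly n)))).integrable (by norm_num)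
    rw [h1]
    simp only [h2]
    rw [integral_finsetSum _ fun l _ => hi l]
    simp only [integral_const_mul, integral_intervalPoly_mul, mul_ite, mul_one, mul_zero,
      Finset.sum_ite_eq']
    split_ifs <;> simp
  have hsum : ∫ x, (x * intervalPoly m x) • w x ∂unitMeasure
      = ∑ n ∈ Finset.range N, opJ 𝕜 m n * ∫ x, intervalPoly n x • w x ∂unitMeasure := by
    have hi : ∀ n, Integrable (fun x => a n • intervalPoly n x • w x) unitMeasure := fun n =>
      (integrable_smul_unit (continuous_intervalPoly n) hw).smul (a n)
    simp only [ha', Finset.sum_smul, mul_smul]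
    rw [integral_finsetSum _ fun n _ => hi n]
    refine Finset.sum_congr rfl fun n hn => ?_
    rw [integral_smul, hJ, if_pos hn, RCLike.real_smul_eq_coe_mul]
  rw [hsum]
  exact hasSum_sum_of_ne_finset_zero fun n hn => by rw [hJ, if_neg hn, zero_mul]

/-- The Volterra operator, on functions that are square integrable for the weight `1 - x`, and its
matrix. -/
theorem method_eq_volterra {K : ℝ → ℝ → 𝕜}
    (hK : MemLp (fun p : ℝ × ℝ => K p.1 p.2) 2 triMeasure) {u : ℝ → 𝕜} (hu : MemWeightedL2 u) :
    (∀ᵐ x ∂unitMeasure, IntervalIntegrable (fun y => K x y * u y) volume 0 (1 - x)) ∧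
    Integrable (volterra K u) unitMeasure ∧
    MethodConverges K (intervalCoeff u) ∧
    intervalCoeff (volterra K u) = methodOp K (intervalCoeff u) := by
  have hu2 := hu.memLp_snd.2
  have hKu : Integrable (fun p : ℝ × ℝ => K p.1 p.2 * u p.2) triMeasure := hK.integrable_mul hu2
  have hV : Integrable (volterra K u) unitMeasure := integrable_integral_row hKu
  have hE : matVec (opE 𝕜) (intervalCoeff u) = triangleCoeff (fun _ y => u y) :=
    funext fun p => (hasSum_opE hu p).tsum_eq
  have hM : matVec (opKernel K) (matVec (opE 𝕜) (intervalCoeff u))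
      = triangleCoeff (fun x y => K x y * u y) := by
    rw [hE]
    exact funext fun p => (hasSum_opKernel hK (F := fun _ y => u y) hu2 p).tsum_eq
  have hQ : opQKE K (intervalCoeff u)
      = fun m => ∫ x, intervalPoly m x • volterra K u x ∂unitMeasure := by
    funext m
    rw [opQKE, hM]
    exact (hasSum_opQ _ m).tsum_eq.trans
      (triangleCoeff_zero (F := fun x y => K x y * u y) hKu m)
  refine ⟨integrable_row hKu, hV, ⟨fun p => (hasSum_opE hu p).summable, fun p => ?_,
    fun m => (hasSum_opQ _ m).summable, fun m => ?_⟩, ?_⟩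
  · rw [hE]
    exact (hasSum_opKernel hK (F := fun _ y => u y) hu2 p).summable
  · rw [hQ]
    exact (hasSum_opJ hV m).summable
  · funext m
    rw [methodOp, Pi.sub_apply, hQ]
    have hJ : matVec (opJ 𝕜) (fun m => ∫ x, intervalPoly m x • volterra K u x ∂unitMeasure) m
        = ∫ x, (x * intervalPoly m x) • volterra K u x ∂unitMeasure := (hasSum_opJ hV m).tsum_eq
    rw [hJ]
    -- The difference of the two unweighted integrals has the factor `p_m - x p_m = (1-x) p_m`, the
    -- weight in `intervalCoeff`.
    refine Eq.trans ?_ (integral_sub (integrable_smul_unit (continuous_intervalPoly m) hV)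
      (integrable_smul_unit (g := fun x => x * intervalPoly m x)
        (continuous_id.mul (continuous_intervalPoly m)) hV))
    refine integral_congr_ae (Filter.Eventually.of_forall fun x => ?_)
    beta_reduce
    rw [← sub_smul]
    congr 1
    ring

/-! #### Multiplication operators on the triangle -/

/-- Column `q` of the right factor is the coefficient vector of `L p_q`, so each entry of the
product is an instance of `hasSum_opKernel`. -/
lemma matMul_opKernel {K L : ℝ → ℝ → 𝕜}
    (hK : MemLp (fun p : ℝ × ℝ => K p.1 p.2) 2 triMeasure)
    (hL : MemLp (fun p : ℝ × ℝ => L p.1 p.2) 2 triMeasure) :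
    matMul (opKernel K) (opKernel L) = opKernel fun x y => K x y * L x y := by
  funext p q
  have hLq : MemLp (fun z : ℝ × ℝ => L z.1 z.2 * ((trianglePoly q z.1 z.2 : ℝ) : 𝕜)) 2
      triMeasure := by
    refine (memLp_trianglePoly_smul q hL).ae_eq (Filter.Eventually.of_forall fun z => ?_)
    simp only [RCLike.real_smul_eq_coe_mul, mul_comm]
  refine (hasSum_opKernel hK
    (F := fun x y => L x y * ((trianglePoly q x y : ℝ) : 𝕜)) hLq p).tsum_eq.trans ?_
  simp only [opKernel, mul_assoc]

lemma memLp_of_continuous_triangle {F : ℝ × ℝ → 𝕜} (hF : Continuous F) : MemLp F 2 triMeasure := by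
  obtain ⟨B, hB⟩ := isCompact_triangle.exists_bound_of_continuousOn hF.continuousOn
  exact MemLp.of_bound hF.aestronglyMeasurable B (ae_mem_triangle.mono hB)

lemma matPow_opKernel {g : ℝ → ℝ → 𝕜} (hg : Continuous fun p : ℝ × ℝ => g p.1 p.2) (n : ℕ) :
    matPow (opKernel g) n = opKernel fun x y => g x y ^ n := by
  induction n with
  | zero =>
    funext p q
    have h : opKernel (fun x y => g x y ^ 0) p q
        = ((∫ z, trianglePoly p z.1 z.2 * trianglePoly q z.1 z.2 ∂triMeasure : ℝ) : 𝕜) := by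
      rw [← integral_ofReal]
      simp only [opKernel, triangleCoeff, pow_zero, one_mul, RCLike.real_smul_eq_coe_mul,
        RCLike.ofReal_mul]
    rw [h, integral_trianglePoly_mul, matPow]
    by_cases hpq : p = q <;> simp [hpq]
  | succ n ih =>
    rw [matPow, ih, matMul_opKernel (memLp_of_continuous_triangle hg)
      (memLp_of_continuous_triangle (hg.pow n))]
    simp only [pow_succ']

/-- For a polynomial kernel, the multiplication operator is that polynomial in the Jacobi
matrices. -/
theorem opKernel_polynomial (K : ℝ → ℝ → 𝕜) (N : ℕ) (k : ℕ → ℕ → 𝕜)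
    (hK : ∀ᵐ p ∂triMeasure, K p.1 p.2 =
      ∑ n ∈ Finset.range (N + 1), ∑ j ∈ Finset.range (n + 1),
        k n j * (p.1 : 𝕜) ^ (n - j) * (p.2 : 𝕜) ^ j) :
    opKernel K = ∑ n ∈ Finset.range (N + 1), ∑ j ∈ Finset.range (n + 1),
      k n j • matMul (matPow (opJx 𝕜) (n - j)) (matPow (opJy 𝕜) j) := by
  have hx : Continuous fun p : ℝ × ℝ => ((p.1 : ℝ) : 𝕜) :=
    RCLike.continuous_ofReal.comp continuous_fst
  have hy : Continuous fun p : ℝ × ℝ => ((p.2 : ℝ) : 𝕜) :=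
    RCLike.continuous_ofReal.comp continuous_snd
  have hmon : ∀ i j, matMul (matPow (opJx 𝕜) i) (matPow (opJy 𝕜) j)
      = opKernel fun x y => (x : 𝕜) ^ i * (y : 𝕜) ^ j := by
    intro i j
    rw [opJx, opJy, matPow_opKernel (g := fun x _ => (x : 𝕜)) hx,
      matPow_opKernel (g := fun _ y => (y : 𝕜)) hy,
      matMul_opKernel (memLp_of_continuous_triangle (hx.pow i))
        (memLp_of_continuous_triangle (hy.pow j))]
  simp only [hmon]
  funext p q
  simp only [Finset.sum_apply, Pi.smul_apply, smul_eq_mul]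
  have hi : ∀ n j, Integrable (fun z : ℝ × ℝ => k n j * trianglePoly p z.1 z.2 •
      ((z.1 : 𝕜) ^ (n - j) * (z.2 : 𝕜) ^ j * ((trianglePoly q z.1 z.2 : ℝ) : 𝕜))) triMeasure := by
    intro n j
    refine Integrable.const_mul (integrable_trianglePoly_smul p (F := fun z : ℝ × ℝ =>
      (z.1 : 𝕜) ^ (n - j) * (z.2 : 𝕜) ^ j * ((trianglePoly q z.1 z.2 : ℝ) : 𝕜)) ?_) _
    exact (memLp_of_continuous_triangle ((hx.pow _).mul (hy.pow _))).integrable_mul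
      (memLp_trianglePoly q).ofReal
  have : opKernel K p q = ∫ z, ∑ n ∈ Finset.range (N + 1), ∑ j ∈ Finset.range (n + 1),
      k n j * trianglePoly p z.1 z.2 • ((z.1 : 𝕜) ^ (n - j) * (z.2 : 𝕜) ^ j *
        ((trianglePoly q z.1 z.2 : ℝ) : 𝕜)) ∂triMeasure := by
    refine integral_congr_ae ?_
    filter_upwards [hK] with z hz
    rw [hz]
    simp only [Finset.sum_mul, Finset.smul_sum, RCLike.real_smul_eq_coe_mul]
    refine Finset.sum_congr rfl fun n _ => Finset.sum_congr rfl fun j _ => ?_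
    ring
  rw [this, integral_finsetSum _ fun n _ => integrable_finsetSum _ fun j _ => hi n j]
  refine Finset.sum_congr rfl fun n _ => ?_
  rw [integral_finsetSum _ fun j _ => hi n j]
  refine Finset.sum_congr rfl fun j _ => ?_
  rw [integral_const_mul]
  rfl

end Method

/-! ### Compactness of the Volterra operator -/

section Volterra

variable {𝕜 : Type*} [RCLike 𝕜]

lemma intervalCoeff_congr {u v : ℝ → 𝕜} (h : u =ᵐ[unitMeasure] v) :
    intervalCoeff u = intervalCoeff v :=
  funext fun _ => integral_congr_ae (h.mono fun x hx => by simp only [hx])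

lemma volterra_congr (K : ℝ → ℝ → 𝕜) {u v : ℝ → 𝕜} (h : u =ᵐ[unitMeasure] v) {x : ℝ}
    (hx : x ∈ Set.Ioo (0 : ℝ) 1) : volterra K u x = volterra K v x := by
  refine intervalIntegral.integral_congr_ae ?_
  have h' := (ae_restrict_iff' measurableSet_Ioo).mp h
  filter_upwards [h'] with y hy hyI
  rw [Set.uIoc_of_le (by linarith [hx.2])] at hyI
  rw [hy ⟨hyI.1, by linarith [hyI.2, hx.1]⟩]

lemma memWeightedL2_of_memLp {u : ℝ → 𝕜} (hu : MemLp u 2 unitMeasure) : MemWeightedL2 u := by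
  refine hu.of_le_mul (c := 1) ((Measurable.aestronglyMeasurable (by fun_prop)).smul hu.1) ?_
  filter_upwards [ae_mem_unit] with x hx
  rw [norm_smul, Real.norm_of_nonneg (Real.sqrt_nonneg _)]
  gcongr
  exact Real.sqrt_le_one.mpr (by linarith [hx.1])

/-- The Volterra operator with a square integrable kernel is compact on `L²(0,1)`. -/
theorem exists_compact_volterra {K : ℝ → ℝ → 𝕜}
    (hK : MemLp (fun p : ℝ × ℝ => K p.1 p.2) 2 triMeasure) :
    ∃ W : L2I 𝕜 →L[𝕜] L2I 𝕜,
      (∀ u : L2I 𝕜, W u =ᵐ[unitMeasure] volterra K u) ∧ IsCompactOperator W := by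
  -- Extension of `K` by zero to the square turns the variable upper limit into an integral over
  -- `(0,1)`.
  rw [triMeasure_eq, ← memLp_indicator_iff_restrict measurableSet_triangle] at hK
  obtain ⟨W, hW, hc⟩ := exists_compact_integral_operator
    (f := fun x y => triangle.indicator (fun p : ℝ × ℝ => K p.1 p.2) (x, y)) hK
  refine ⟨W, fun u => ?_, hc⟩
  filter_upwards [hW u, ae_mem_unit] with x hx hxI
  rw [hx, volterra, ← integral_indicator_row hxI fun p => K p.1 p.2 * u p.2]
  simp only [Set.indicator, ite_mul, zero_mul]

/-- Multiplication by `√(1 - x)`, from the weighted space to `L²(0,1)`. -/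
def MemWeightedL2.lift {u : ℝ → 𝕜} (hu : MemWeightedL2 u) : L2I 𝕜 :=
  MemLp.toLp (fun x => √(1 - x) • u x) hu

lemma MemWeightedL2.coeFn_lift {u : ℝ → 𝕜} (hu : MemWeightedL2 u) :
    hu.lift =ᵐ[unitMeasure] fun x => √(1 - x) • u x := MemLp.coeFn_toLp hu

lemma exists_lift_eq (v : L2I 𝕜) : ∃ (u : ℝ → 𝕜) (hu : MemWeightedL2 u), hu.lift = v := by
  have h : (fun x => √(1 - x) • (√(1 - x))⁻¹ • v x) =ᵐ[unitMeasure] v := by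
    filter_upwards [ae_mem_unit] with x hx
    rw [smul_inv_smul₀ (Real.sqrt_pos.mpr (by linarith [hx.2])).ne']
  have hu : MemWeightedL2 (fun x => (√(1 - x))⁻¹ • v x) := (Lp.memLp v).ae_eq h.symm
  exact ⟨_, hu, Lp.ext (hu.coeFn_lift.trans h)⟩

variable (𝕜) in
/-- The coefficient map of the weighted space, as an isometry `L²(0,1) ≃ ℓ²`. -/
def weightedRepr : L2I 𝕜 ≃ₗᵢ[𝕜] lp (fun _ : ℕ => 𝕜) 2 :=
  (isOrthonormalBasis_weightedPoly (𝕜 := 𝕜)).hilbertBasis.repr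

lemma weightedRepr_lift {u : ℝ → 𝕜} (hu : MemWeightedL2 u) :
    (weightedRepr 𝕜 hu.lift : ℕ → 𝕜) = intervalCoeff u := by
  funext n
  rw [intervalCoeff_eq, weightedRepr, IsOrthonormalBasis.repr_apply]
  exact integral_smul_toLp (weightedPoly n) (f := fun x => √(1 - x) • u x) hu

lemma lift_eq_of_ae {u : ℝ → 𝕜} (hu : MemWeightedL2 u) {w : L2I 𝕜}
    (h : w =ᵐ[unitMeasure] fun x => √(1 - x) • u x) : hu.lift = w :=
  Lp.ext (hu.coeFn_lift.trans h.symm)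

/-- The conjugate of the Volterra operator by multiplication by `√(1 - x)` is compact. -/
theorem exists_compact_weighted_volterra {K : ℝ → ℝ → 𝕜}
    (hK : MemLp (fun p : ℝ × ℝ => (√(1 - p.2))⁻¹ • K p.1 p.2) 2 triMeasure) :
    ∃ W : L2I 𝕜 →L[𝕜] L2I 𝕜, IsCompactOperator W ∧ ∀ (u : ℝ → 𝕜) (hu : MemWeightedL2 u),
      ∃ hV : MemWeightedL2 (volterra K u), hV.lift = W hu.lift := by
  -- This is the kernel of the conjugated operator. Since `√(1-x) ≤ 1`, the hypothesis on `K/√(1-y)`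
  -- suffices.
  have hK2 : MemLp (fun p : ℝ × ℝ => √(1 - p.1) • (√(1 - p.2))⁻¹ • K p.1 p.2) 2 triMeasure := by
    refine hK.of_le_mul (c := 1)
      ((Measurable.aestronglyMeasurable (by fun_prop)).smul hK.1) ?_
    filter_upwards [ae_mem_triangle] with p hp
    rw [norm_smul, Real.norm_of_nonneg (Real.sqrt_nonneg _)]
    gcongr
    exact Real.sqrt_le_one.mpr (by linarith [hp.1])
  obtain ⟨W, hW, hc⟩ := exists_compact_volterra
    (K := fun x y => √(1 - x) • (√(1 - y))⁻¹ • K x y) hK2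
  refine ⟨W, hc, fun u hu => ?_⟩
  have h : W hu.lift =ᵐ[unitMeasure] fun x => √(1 - x) • volterra K u x := by
    filter_upwards [hW hu.lift, ae_mem_unit] with x hx hxI
    rw [hx, volterra_congr _ hu.coeFn_lift hxI, volterra, volterra,
      ← intervalIntegral.integral_smul]
    refine intervalIntegral.integral_congr_ae (Filter.Eventually.of_forall fun y hy => ?_)
    rw [Set.uIoc_of_le (by linarith [hxI.2])] at hy
    have hy1 : √(1 - y) ≠ 0 := (Real.sqrt_pos.mpr (by linarith [hy.2, hxI.1])).ne'
    rw [smul_mul_assoc, smul_mul_smul_comm, inv_mul_cancel₀ hy1, one_smul]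
  have hV : MemWeightedL2 (volterra K u) := (Lp.memLp _).ae_eq h
  exact ⟨hV, lift_eq_of_ae hV h⟩

end Volterra

end JacobiVolterra

end

theorem mainTheorem8 {𝕜 : Type*} [RCLike 𝕜] (K : ℝ → ℝ → 𝕜)
    (hK : MemLp (fun p : ℝ × ℝ => K p.1 p.2) 2 (volume.restrict triangle)) :
    -- for a polynomial kernel, `K(J_x, J_y)` is that polynomial in the Jacobi matrices
    (∀ (N : ℕ) (k : ℕ → ℕ → 𝕜),
      (∀ᵐ p ∂(volume.restrict triangle), K p.1 p.2 =
        ∑ n ∈ Finset.range (N + 1), ∑ j ∈ Finset.range (n + 1),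
          k n j * (p.1 : 𝕜) ^ (n - j) * (p.2 : 𝕜) ^ j) →
      opKernel K = ∑ n ∈ Finset.range (N + 1), ∑ j ∈ Finset.range (n + 1),
        k n j • matMul (matPow (opJx 𝕜) (n - j)) (matPow (opJy 𝕜) j)) ∧
    -- the vectors in `ℓ²` are the coefficient vectors of the functions `u` that are square
    -- integrable for the weight `1 - x`, and on them `V_K = (1 - J) Q_y K(J_x, J_y) E_y`
    (∀ c : ℕ → 𝕜, Memℓp c 2 → ∃ u : ℝ → 𝕜, MemWeightedL2 u ∧ intervalCoeff u = c) ∧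
    (∀ u : ℝ → 𝕜, MemWeightedL2 u →
      Memℓp (intervalCoeff u) 2 ∧
      (∀ᵐ x ∂(volume.restrict (Set.Ioo (0 : ℝ) 1)),
        IntervalIntegrable (fun y => K x y * u y) volume 0 (1 - x)) ∧
      IntegrableOn (volterra K u) (Set.Ioo (0 : ℝ) 1) ∧
      MethodConverges K (intervalCoeff u) ∧
      intervalCoeff (volterra K u) = methodOp K (intervalCoeff u)) ∧
    -- compactness on `L²(0,1)` and on its space of coefficient vectors, and the second kind method
    (∃ (W : L2I 𝕜 →L[𝕜] L2I 𝕜) (V : CoeffSpace 𝕜 →L[𝕜] CoeffSpace 𝕜),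
      (∀ u : L2I 𝕜, W u =ᵐ[volume.restrict (Set.Ioo (0 : ℝ) 1)] volterra K u) ∧
      (∀ c : CoeffSpace 𝕜, V c = analysis 𝕜 (W ((analysis 𝕜).symm c))) ∧
      (∀ c : CoeffSpace 𝕜, (V c).toSeq = methodOp K c.toSeq) ∧
      IsCompactOperator W ∧
      IsCompactOperator V ∧
      ∃ C : CoeffSpace 𝕜 →L[𝕜] CoeffSpace 𝕜, IsCompactOperator C ∧
        (∀ c : CoeffSpace 𝕜, ((1 + C) c).toSeq = c.toSeq - methodOp K c.toSeq) ∧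
        ∀ u g : L2I 𝕜,
          (∀ᵐ x ∂(volume.restrict (Set.Ioo (0 : ℝ) 1)), u x - volterra K u x = g x) ↔
            (1 + C) (analysis 𝕜 u) = analysis 𝕜 g) ∧
    -- compactness on `ℓ²`, and the second kind method there
    (MemLp (fun p : ℝ × ℝ => (√(1 - p.2))⁻¹ • K p.1 p.2) 2 (volume.restrict triangle) →
      ∃ V : lp (fun _ : ℕ => 𝕜) 2 →L[𝕜] lp (fun _ : ℕ => 𝕜) 2,
        (∀ c : lp (fun _ : ℕ => 𝕜) 2, (V c : ℕ → 𝕜) = methodOp K c) ∧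
        (∀ u : ℝ → 𝕜, MemWeightedL2 u → MemWeightedL2 (volterra K u)) ∧
        IsCompactOperator V ∧
        ∃ C : lp (fun _ : ℕ => 𝕜) 2 →L[𝕜] lp (fun _ : ℕ => 𝕜) 2, IsCompactOperator C ∧
          (∀ c : lp (fun _ : ℕ => 𝕜) 2, ((1 + C) c : ℕ → 𝕜) = (c : ℕ → 𝕜) - methodOp K c) ∧
          ∀ u g : ℝ → 𝕜, MemWeightedL2 u → MemWeightedL2 g →
            ∀ c d : lp (fun _ : ℕ => 𝕜) 2,
              (c : ℕ → 𝕜) = intervalCoeff u → (d : ℕ → 𝕜) = intervalCoeff g →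
              ((∀ᵐ x ∂(volume.restrict (Set.Ioo (0 : ℝ) 1)), u x - volterra K u x = g x) ↔
                (1 + C) c = d)) := by
  refine ⟨opKernel_polynomial K, fun c hc => ?_, fun u hu => ?_, ?_, fun hK' => ?_⟩
  · obtain ⟨u, hu, hv⟩ := exists_lift_eq ((weightedRepr 𝕜).symm ⟨c, hc⟩)
    refine ⟨u, hu, ?_⟩
    rw [← weightedRepr_lift hu, hv, LinearIsometryEquiv.apply_symm_apply]
  · refine ⟨?_, method_eq_volterra hK hu⟩
    rw [← weightedRepr_lift hu]
    exact lp.memℓp _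
  · obtain ⟨W, hW, hcW⟩ := exists_compact_volterra hK
    let A := (analysis 𝕜).toContinuousLinearEquiv
    let V : CoeffSpace 𝕜 →L[𝕜] CoeffSpace 𝕜 :=
      (A : L2I 𝕜 →L[𝕜] CoeffSpace 𝕜) ∘L W ∘L (A.symm : CoeffSpace 𝕜 →L[𝕜] L2I 𝕜)
    have hVA : ∀ c, V c = analysis 𝕜 (W ((analysis 𝕜).symm c)) := fun _ => rfl
    have hVm : ∀ c : CoeffSpace 𝕜, (V c).toSeq = methodOp K c.toSeq := by
      intro c
      obtain ⟨u, rfl⟩ := (analysis 𝕜).surjective c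
      rw [hVA, LinearIsometryEquiv.symm_apply_apply, toSeq_analysis, toSeq_analysis,
        intervalCoeff_congr (hW u)]
      exact (method_eq_volterra hK (memWeightedL2_of_memLp (Lp.memLp u))).2.2.2
    have hcV : IsCompactOperator V :=
      (hcW.comp_clm (A.symm : CoeffSpace 𝕜 →L[𝕜] L2I 𝕜)).clm_comp (A : L2I 𝕜 →L[𝕜] CoeffSpace 𝕜)
    have hC : ∀ c, (1 + -V) c = c - V c := fun c => by
      rw [add_apply, neg_apply,
        one_apply_eq_self, sub_eq_add_neg]
    refine ⟨W, V, hW, hVA, hVm, hcW, hcV, -V, hcV.neg, fun c => ?_, fun u g => ?_⟩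
    · rw [hC, ← hVm]
      rfl
    -- Injectivity of the analysis operator reduces the coefficient equation to `u - W u = g` in
    -- `L²(0,1)`.
    · rw [hC, hVA, LinearIsometryEquiv.symm_apply_apply, ← map_sub,
        (analysis 𝕜).injective.eq_iff, Lp.ext_iff]
      refine Filter.eventually_congr ?_
      filter_upwards [Lp.coeFn_sub u (W u), hW u] with x h1 h2
      rw [h1, Pi.sub_apply, h2]
  · obtain ⟨W, hcW, hW⟩ := exists_compact_weighted_volterra hK'
    let R := (weightedRepr 𝕜).toContinuousLinearEquiv
    let V : lp (fun _ : ℕ => 𝕜) 2 →L[𝕜] lp (fun _ : ℕ => 𝕜) 2 :=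
      (R : L2I 𝕜 →L[𝕜] lp (fun _ : ℕ => 𝕜) 2) ∘L W ∘L
        (R.symm : lp (fun _ : ℕ => 𝕜) 2 →L[𝕜] L2I 𝕜)
    have hVR : ∀ v, V (weightedRepr 𝕜 v) = weightedRepr 𝕜 (W v) := fun v =>
      congrArg (fun v => weightedRepr 𝕜 (W v)) ((weightedRepr 𝕜).symm_apply_apply v)
    have hVm : ∀ c : lp (fun _ : ℕ => 𝕜) 2, (V c : ℕ → 𝕜) = methodOp K c := by
      intro c
      -- Every vector in `ℓ²` is the coefficient vector of a weighted function, so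
      -- `method_eq_volterra` determines `V` on all of `ℓ²`.
      obtain ⟨v, rfl⟩ := (weightedRepr 𝕜).surjective c
      obtain ⟨u, hu, rfl⟩ := exists_lift_eq v
      obtain ⟨hVu, hWu⟩ := hW u hu
      rw [hVR, ← hWu, weightedRepr_lift, weightedRepr_lift]
      exact (method_eq_volterra hK hu).2.2.2
    have hcV : IsCompactOperator V :=
      (hcW.comp_clm (R.symm : lp (fun _ : ℕ => 𝕜) 2 →L[𝕜] L2I 𝕜)).clm_comp
        (R : L2I 𝕜 →L[𝕜] lp (fun _ : ℕ => 𝕜) 2)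
    have hC : ∀ c, (1 + -V) c = c - V c := fun c => by
      rw [add_apply, neg_apply,
        one_apply_eq_self, sub_eq_add_neg]
    refine ⟨V, hVm, fun u hu => (hW u hu).1, hcV, -V, hcV.neg, fun c => ?_,
      fun u g hu hg c d hc hd => ?_⟩
    · rw [hC, ← hVm]
      rfl
    · obtain rfl : c = weightedRepr 𝕜 hu.lift := lp.ext (hc.trans (weightedRepr_lift hu).symm)
      obtain rfl : d = weightedRepr 𝕜 hg.lift := lp.ext (hd.trans (weightedRepr_lift hg).symm)
      obtain ⟨hVu, hWu⟩ := hW u hu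
      rw [hC, hVR, ← hWu, ← map_sub, (weightedRepr 𝕜).injective.eq_iff, Lp.ext_iff]
      refine Filter.eventually_congr ?_
      filter_upwards [Lp.coeFn_sub hu.lift hVu.lift, hu.coeFn_lift, hVu.coeFn_lift,
        hg.coeFn_lift, ae_mem_unit] with x h1 h2 h3 h4 hx
      rw [h1, Pi.sub_apply, h2, h3, h4, ← smul_sub]
      -- The lifted equation is the original one times `√(1-x)`, which is nonzero on `(0,1)`.
      exact (smul_right_injective 𝕜 (Real.sqrt_pos.mpr (by linarith [hx.2])).ne').eq_iff.symm
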